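/- Let $K$ be an algebraically closed field of characteristic zero, let $n\ge 2$ and $s\ge 2$ be integers, $S=K[x_0,\dots,x_n]$ and $\mathfrak m=(x_0,\dots,x_n)$. Let $F,P\in S$ be forms of the same degree $d$ which are a regular sequence and cut out a smooth complete intersection $Z\subset\mathbb P^n$ of codimension two (that is, the Jacobian matrix of $(F,P)$ has rank $2$ at every point of $Z$), so that $I_Z=(F,P)$. For $i=1,\dots,s$ let $G_i=a_iF+b_iP$ with $a_i,b_i\in K$ be forms defining $s$ distinct smooth hypersurfaces of $\mathbb P^n$. Put $$G=\prod_{i=1}^s G_i,\qquad J=\operatorname{Jac}(G)=\Big(\frac{\partial G}{\partial x_0},\dots,\frac{\partial G}{\partial x_n}\Big),\qquad H_1=\sum_{i=1}^s a_i\frac{G}{G_i},\qquad H_2=\sum_{i=1}^s b_i\frac{G}{G_i}.$$ Let $J^{sat}=\bigcup_k (J:\mathfrak m^k)$ be the saturation of $J$, and let $J^{top}$ be the intersection of the components of codimension two in a minimal primary decomposition of $J$. Call a saturated homogeneous ideal $I\subset S$ ACM if $S/I$ is a Cohen-Macaulay ring. Then: 1. $J^{sat}=(H_1,H_2)$, and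 this is a complete intersection of type $((s-1)d,(s-1)d)$: $H_1,H_2$ are forms of degree $(s-1)d$ and are a regular sequence in $S$. 2. $J^{top}=J^{sat}$ (for every minimal primary decomposition of $J$), and this ideal is ACM. 3. $\sqrt J=I_Z=(F,P)$, and this ideal is ACM. -/

import Mathlib

open MvPolynomial

noncomputable section

namespace JacobianArrangement

/-! ### Cohen-Macaulay rings -/

/-- The depth of a local ring: the supremum of the lengths of the regular sequences contained in
its maximal ideal. -/
def localDepth (R : Type*) [CommRing R] [IsLocalRing R] : ℕ∞ :=
  ⨆ (rs : List R) (_ : ∀ r ∈ rs, r ∈ IsLocalRing.maximalIdeal R)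
    (_ : RingTheory.Sequence.IsRegular R rs), (rs.length : ℕ∞)

/-- A Noetherian ring is Cohen-Macaulay if, for every maximal ideal, the localization there has
depth equal to its Krull dimension. -/
def IsCohenMacaulay (R : Type*) [CommRing R] : Prop :=
  IsNoetherianRing R ∧ ∀ (M : Ideal R) [M.IsMaximal],
    (localDepth (Localization.AtPrime M) : WithBot ℕ∞) = ringKrullDim (Localization.AtPrime M)

/-! ### Forms in `K[x₀, …, xₙ]` and the subschemes of projective space they define -/

variable {K : Type*} [Field K] {n : ℕ}

/-- The saturation `⋃ₖ (I : 𝔪ᵏ)` of an ideal with respect to the irrelevant ideal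
`𝔪 = (x₀, …, xₙ)`. -/
def saturation (I : Ideal (MvPolynomial (Fin (n + 1)) K)) :
    Ideal (MvPolynomial (Fin (n + 1)) K) :=
  ⨆ k : ℕ, I.colon (((idealOfVars (Fin (n + 1)) K) ^ k : Ideal _) : Set _)

/-- The Jacobian ideal of `G`, generated by all the first partial derivatives of `G`. -/
def jacobianIdeal (G : MvPolynomial (Fin (n + 1)) K) : Ideal (MvPolynomial (Fin (n + 1)) K) :=
  Ideal.span (Set.range fun k => pderiv k G)

/-- `I` is the saturated homogeneous ideal of an arithmetically Cohen-Macaulay subscheme of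
projective space. -/
structure IsACM (I : Ideal (MvPolynomial (Fin (n + 1)) K)) : Prop where
  homogeneous : ∀ f ∈ I, ∀ k : ℕ, homogeneousComponent k f ∈ I
  saturated : saturation I = I
  cohenMacaulay : IsCohenMacaulay (MvPolynomial (Fin (n + 1)) K ⧸ I)

/-- The intersection of the components of codimension two in a finite family of ideals.  When `t`
is a minimal primary decomposition of an ideal `J` of codimension two, this is the top dimensional
part of `J`. -/
def codimTwoPart (t : Finset (Ideal (MvPolynomial (Fin (n + 1)) K))) :
    Ideal (MvPolynomial (Fin (n + 1)) K) :=
  ⨅ q ∈ {q | q ∈ t ∧ q.height = 2}, q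

/-- For `K` algebraically closed: the subscheme of projective space cut out by the forms
`f₁, …, fᵣ` is smooth of codimension `r` (or empty), i.e. the Jacobian matrix of the forms has
rank `r` at each of its points.  A point of projective space is given by a nonzero vector `x` of
homogeneous coordinates.  For `r = 1` this says that the form defines a smooth hypersurface. -/
def IsSmoothCutOut {r : ℕ} (f : Fin r → MvPolynomial (Fin (n + 1)) K) : Prop :=
  ∀ x : Fin (n + 1) → K, x ≠ 0 → (∀ i, eval x (f i) = 0) →
    LinearIndependent K fun (i : Fin r) (k : Fin (n + 1)) => eval x (pderiv k (f i))

/-- The form `∑ᵢ cᵢ G / Gᵢ`, where `G` is the product of the `Gᵢ`. -/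
def weightedCofactorSum {s : ℕ} (c : Fin s → K) (G : Fin s → MvPolynomial (Fin (n + 1)) K) :
    MvPolynomial (Fin (n + 1)) K :=
  ∑ i, C (c i) * ∏ j ∈ Finset.univ.erase i, G j

end JacobianArrangement

end

/-! The product rule gives `∂ₖG = H₁ ∂ₖF + H₂ ∂ₖP`, so `J ⊆ (H₁, H₂)`, and by Cramer's rule the 2×2
minors of the Jacobian matrix of `(F, P)` multiply `(H₁, H₂)` into `J`. At a nonzero singular point
of `G`, Euler's formula and `H₁F + H₂P = sG` show that some `Gᵢ` vanishes. If it were the only one,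
`∇G` would be a nonzero multiple of `∇Gᵢ`, against smoothness. So two members vanish, hence `F` and
`P` do, and there some minor is nonzero. Thus `J : (H₁, H₂)` has no zero but the origin and contains
a power of `𝔪` (`exists_pow_idealOfVars_le_colon`).

The rest is unmixedness: associated primes of a codimension two complete intersection have height at
most 2 (`height_colon_le_two`), while `𝔪` has height `n + 1 ≥ 3`. Hence `(H₁, H₂)` is saturated and
equals `J^sat`, and it agrees with the codimension two components of `J`
(`codimTwoPart_eq_span_pair`). The pair `H₁, H₂` is regular since a common prime factor would divide
`F` and `P`. Finally `J` and `(F, P)` have the same zeros, and `(F, P)` is radical by the Jacobian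
criterion (`isRadical_span_pair`). -/

noncomputable section

namespace JacobianArrangement

/-! ### Depth, associated primes and regularity over a Noetherian local ring -/

section LocalAlgebra

open IsLocalRing RingTheory.Sequence
open scoped Pointwise

universe u

/-- There is an `M`-regular sequence of length `k` in the maximal ideal of the local ring `R`. -/
def HasRegularSeq (R : Type u) [CommRing R] [IsLocalRing R] (k : ℕ) (M : Type u) [AddCommGroup M]
    [Module R M] : Prop :=
  ∃ rs : List R, rs.length = k ∧ (∀ r ∈ rs, r ∈ maximalIdeal R) ∧ IsRegular M rs

variable {R : Type u} [CommRing R] [IsLocalRing R]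

theorem HasRegularSeq.of_linearEquiv {k : ℕ} {M N : Type u} [AddCommGroup M] [Module R M]
    [AddCommGroup N] [Module R N] (e : M ≃ₗ[R] N) (h : HasRegularSeq R k M) :
    HasRegularSeq R k N := by
  obtain ⟨rs, hl, hm, hr⟩ := h
  exact ⟨rs, hl, hm, (e.isRegular_congr rs).1 hr⟩

-- The given sequence need not begin with `x`. Its existence amounts to the vanishing of Ext in
-- degrees below `k + 1`, and the long exact sequence of multiplication by `x` loses exactly one
-- degree.
open CategoryTheory Abelian Limits in
theorem HasRegularSeq.quotSMulTop [IsNoetherianRing R] {k : ℕ} {M : Type u} [AddCommGroup M]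
    [Module R M] [Module.Finite R M] (h : HasRegularSeq R (k + 1) M) {x : R}
    (hx : x ∈ maximalIdeal R) (hreg : IsSMulRegular M x) :
    HasRegularSeq R k (QuotSMulTop x M) := by
  obtain ⟨rs, hl, hm, hr⟩ := h
  have : Nontrivial M := hr.nontrivial
  have : Nontrivial (QuotSMulTop x M) := nontrivial_quotSMulTop_of_mem_maximalIdeal M hx
  have smul_lt (N : Type u) [AddCommGroup N] [Module R N] [Module.Finite R N] [Nontrivial N] :
      maximalIdeal R • (⊤ : Submodule R N) < ⊤ := by
    refine lt_top_iff_ne_top.2 fun h ↦ ?_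
    exact top_ne_bot (α := Submodule R N) (Submodule.eq_bot_of_le_smul_of_le_jacobson_bot
      (maximalIdeal R) ⊤ Module.Finite.fg_top h.ge (maximalIdeal_le_jacobson _))
  have key := (ModuleCat.exists_isRegular_tfae (maximalIdeal R) (k + 1) (ModuleCat.of R M)
    (smul_lt M)).out 1 3
  have hext := key.2 ⟨rs, hl, hm, hr⟩
  have key' := (ModuleCat.exists_isRegular_tfae (maximalIdeal R) k
    (ModuleCat.of R (QuotSMulTop x M)) (smul_lt _)).out 1 3
  refine key'.1 fun i hi ↦ ?_
  have zero1 := AddCommGrpCat.isZero_of_iff_subsingleton.mpr (hext i (by omega))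
  have zero2 := AddCommGrpCat.isZero_of_iff_subsingleton.mpr (hext (i + 1) (by omega))
  exact AddCommGrpCat.subsingleton_of_isZero <| ShortComplex.Exact.isZero_of_both_zeros
    ((Ext.covariant_sequence_exact₃' _
      (IsSMulRegular.smulShortComplex_shortExact (M := ModuleCat.of R M) hreg)) i (i + 1) rfl)
    (zero1.eq_zero_of_src _) (zero2.eq_zero_of_tgt _)

theorem smul_top_quotient_eq_map {R : Type u} [CommRing R] (I : Ideal R) (x : R) :
    x • (⊤ : Submodule R (R ⧸ I)) = Submodule.map (Submodule.mkQ I) (Ideal.span {x}) := by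
  have h : (⊤ : Submodule R (R ⧸ I)) = Submodule.map (Submodule.mkQ I) ⊤ := by
    rw [Submodule.map_top, Submodule.range_mkQ]
  rw [h, ← Submodule.map_pointwise_smul]
  congr 1
  ext y
  simp [Submodule.mem_smul_pointwise_iff_exists, Ideal.mem_span_singleton', mul_comm]

/-- `R/I` modulo `x` is `R/(I + (x))`. -/
def quotSMulTopQuotientEquiv {R : Type u} [CommRing R] (I : Ideal R) (x : R) :
    QuotSMulTop x (R ⧸ I) ≃ₗ[R] R ⧸ (I ⊔ Ideal.span {x}) :=
  (Submodule.quotEquivOfEq _ _ (smul_top_quotient_eq_map I x)).trans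
    (Submodule.quotientQuotientEquivQuotientSup I (Ideal.span {x}))

theorem isSMulRegular_quotient_iff {R : Type u} [CommRing R] (I : Ideal R) (x : R) :
    IsSMulRegular (R ⧸ I) x ↔ ∀ f, x * f ∈ I → f ∈ I :=
  isSMulRegular_quotient_iff_mem_of_smul_mem I x

theorem HasRegularSeq.sup_span_singleton [IsNoetherianRing R] {k : ℕ} {I : Ideal R}
    (h : HasRegularSeq R (k + 1) (R ⧸ I)) {x : R} (hx : x ∈ maximalIdeal R)
    (hreg : ∀ f, x * f ∈ I → f ∈ I) : HasRegularSeq R k (R ⧸ (I ⊔ Ideal.span {x})) :=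
  (h.quotSMulTop hx ((isSMulRegular_quotient_iff I x).2 hreg)).of_linearEquiv
    (quotSMulTopQuotientEquiv I x)

theorem HasRegularSeq.exists_succ {k : ℕ} {I : Ideal R} (h : HasRegularSeq R (k + 1) (R ⧸ I)) :
    ∃ x ∈ maximalIdeal R, (∀ f, x * f ∈ I → f ∈ I) ∧
      HasRegularSeq R k (R ⧸ (I ⊔ Ideal.span {x})) := by
  obtain ⟨_ | ⟨x, rs⟩, hl, hm, hr⟩ := h
  · simp at hl
  · rw [isRegular_cons_iff] at hr
    refine ⟨x, hm x (by simp), (isSMulRegular_quotient_iff I x).1 hr.1, ?_⟩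
    exact HasRegularSeq.of_linearEquiv (quotSMulTopQuotientEquiv I x)
      ⟨rs, by simpa using hl, fun r h ↦ hm r (by simp [h]), hr.2⟩

/-- In a Noetherian ring a proper colon ideal `I : f` lies in a prime of the form `I : g`. -/
theorem exists_isPrime_colon_ge {R : Type u} [CommRing R] [IsNoetherianRing R] (I : Ideal R)
    {f : R} (hf : f ∉ I) :
    ∃ g, (I.colon {g}).IsPrime ∧ I.colon {f} ≤ I.colon {g} := by
  have h0 : Ideal.Quotient.mk I f ≠ 0 := by rwa [Ne, Ideal.Quotient.eq_zero_iff_mem]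
  have hc (g : R) : (⊥ : Submodule R (R ⧸ I)).colon {Ideal.Quotient.mk I g} = I.colon {g} := by
    ext r
    rw [Submodule.mem_colon_singleton, Submodule.mem_colon_singleton, Submodule.mem_bot]
    exact Ideal.Quotient.eq_zero_iff_mem (a := r * g)
  obtain ⟨p, hp, hle⟩ := exists_le_isAssociatedPrime_of_isNoetherianRing R _ h0
  obtain ⟨hp1, x, hx⟩ := isAssociatedPrime_iff.1 hp
  obtain ⟨g, rfl⟩ := Ideal.Quotient.mk_surjective x
  rw [hc] at hle hx
  exact ⟨g, hx ▸ hp1, hx ▸ hle⟩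

theorem mem_colon_singleton_iff {R : Type u} [CommRing R] {I : Ideal R} {f g : R} :
    g ∈ I.colon {f} ↔ g * f ∈ I := Submodule.mem_colon_singleton

theorem notMem_of_isPrime_colon {R : Type u} [CommRing R] {I : Ideal R} {f : R}
    (h : (I.colon {f}).IsPrime) : f ∉ I := fun hf ↦
  h.ne_top ((Ideal.eq_top_iff_one _).2 (mem_colon_singleton_iff.2 (by simpa using hf)))

/-- Depth is at most `dim R/p` for every associated prime `p`. Modulo a regular element `x`, some
associated prime of `I + (x)` strictly contains `p`, so each step of the sequence lengthens a chain
of primes above `p`. -/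
theorem le_coheight_colon [IsNoetherianRing R] {k : ℕ} {I : Ideal R}
    (h : HasRegularSeq R k (R ⧸ I)) {f : R} (hp : (I.colon {f}).IsPrime) :
    (k : ℕ∞) ≤ Order.coheight (⟨I.colon {f}, hp⟩ : PrimeSpectrum R) := by
  induction k generalizing I f with
  | zero => simp
  | succ k ih =>
    obtain ⟨x, hx, hreg, h'⟩ := h.exists_succ
    set p := I.colon {f} with hpdef
    have hf := notMem_of_isPrime_colon hp
    have hIp : I ≤ p := fun i hi ↦ mem_colon_singleton_iff.2 (I.mul_mem_right _ hi)
    set Q : Ideal R := I.colon (p : Set R) with hQ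
    have hIQ : I ≤ Q := fun i hi ↦ Submodule.mem_colon.2 fun s _ ↦ I.mul_mem_right _ hi
    have hfQ : f ∈ Q := Submodule.mem_colon.2 fun s hs ↦ by
      rw [smul_eq_mul, mul_comm]; exact mem_colon_singleton_iff.1 hs
    -- If `Q = I : p` lay in `I + (x)`, regularity of `x` would give `Q ⊆ I + xQ`, hence `Q ⊆ I` by
    -- Nakayama, although `f ∈ Q`.
    obtain ⟨g, hgQ, hg⟩ : ∃ g ∈ Q, g ∉ I ⊔ Ideal.span {x} := by
      by_contra! hcon
      refine hf (Submodule.le_of_le_smul_of_le_jacobson_bot (I := maximalIdeal R) (N := I)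
        (N' := Q) (IsNoetherian.noetherian Q) (maximalIdeal_le_jacobson _) ?_ hfQ)
      intro g hg
      obtain ⟨i, hi, j, hj, rfl⟩ := Submodule.mem_sup.1 (hcon g hg)
      obtain ⟨w, rfl⟩ := Ideal.mem_span_singleton'.1 hj
      refine Submodule.add_mem_sup hi ?_
      rw [mul_comm]
      refine Submodule.smul_mem_smul hx (Submodule.mem_colon.2 fun s hs ↦ hreg _ ?_)
      have h1 : i * s ∈ I := I.mul_mem_right _ hi
      have h2 : (i + w * x) * s ∈ I := Submodule.mem_colon.1 hg s hs
      have h3 := I.sub_mem h2 h1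
      rw [smul_eq_mul]
      convert h3 using 1
      ring
    obtain ⟨g', hg', hle⟩ := exists_isPrime_colon_ge _ hg
    have hlt : p < (I ⊔ Ideal.span {x}).colon {g'} := by
      refine lt_of_le_of_ne ?_ ?_
      · refine le_trans (fun a ha ↦ ?_) hle
        refine mem_colon_singleton_iff.2 (Ideal.mem_sup_left ?_)
        rw [mul_comm]
        exact Submodule.mem_colon.1 hgQ a ha
      · intro he
        have hxp : x ∈ p := by
          rw [he]
          refine hle (mem_colon_singleton_iff.2 (Ideal.mem_sup_right ?_))
          exact Ideal.mul_mem_right _ _ (Ideal.mem_span_singleton_self x)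
        exact hf (hreg f (mem_colon_singleton_iff.1 hxp))
    have h1 := Order.coheight_add_one_le
      (show (⟨p, hp⟩ : PrimeSpectrum R) < ⟨_, hg'⟩ from hlt)
    refine le_trans ?_ h1
    push_cast
    gcongr
    exact ih h' hg'

theorem height_colon_add_le [IsNoetherianRing R] {k : ℕ} {I : Ideal R}
    (h : HasRegularSeq R k (R ⧸ I)) {f : R} (hp : (I.colon {f}).IsPrime) :
    ((I.colon {f}).height + k : ℕ∞) ≤ ringKrullDim R := by
  have h1 := le_coheight_colon h hp
  rw [ringKrullDim, Order.krullDim_eq_iSup_height_add_coheight_of_nonempty, WithBot.coe_le_coe]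
  refine le_trans ?_ (le_iSup _ (⟨I.colon {f}, hp⟩ : PrimeSpectrum R))
  rw [← PrimeSpectrum.height_eq_orderHeight]
  gcongr

theorem le_ringKrullDim_quotient_colon [IsNoetherianRing R] {k : ℕ} {I : Ideal R}
    (h : HasRegularSeq R k (R ⧸ I)) {f : R} (hp : (I.colon {f}).IsPrime) :
    (k : WithBot ℕ∞) ≤ ringKrullDim (R ⧸ I.colon {f}) := by
  have h1 := le_coheight_colon h hp
  have h2 : PrimeSpectrum.zeroLocus (I.colon {f} : Set R) =
      Set.Ici (⟨I.colon {f}, hp⟩ : PrimeSpectrum R) := rfl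
  rw [ringKrullDim_quotient, h2, ← Order.coheight_eq_krullDim_Ici]
  exact WithBot.coe_le_coe.2 h1

/-- This is the fact that a regular local ring is a domain: the maximal ideal of `R/I` has as many
generators as the depth. The induction divides by one generator at a time. -/
theorem isPrime_of_hasRegularSeq_of_generators [IsNoetherianRing R] {k : ℕ} {I : Ideal R}
    (h : HasRegularSeq R k (R ⧸ I)) (z : Fin k → R)
    (hz : maximalIdeal R = I ⊔ Ideal.span (Set.range z)) : I.IsPrime := by
  induction k generalizing I with
  | zero =>
    have : I = maximalIdeal R := by simp [hz]
    rw [this]; infer_instance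
  | succ k ih =>
    have hz0 : z 0 ∈ maximalIdeal R := hz ▸ Ideal.mem_sup_right (Ideal.subset_span ⟨0, rfl⟩)
    have hIm : I ≤ maximalIdeal R := hz ▸ le_sup_left
    have hsplit : maximalIdeal R =
        (I ⊔ Ideal.span {z 0}) ⊔ Ideal.span (Set.range fun i : Fin k ↦ z i.succ) := by
      rw [hz, sup_assoc, ← Ideal.span_union, Fin.range_fin_succ]
      rfl
    -- If an associated prime `p` contained `z 0`, the maximal ideal of `R/p` would have `k`
    -- generators, while `dim R/p ≥ k + 1`.
    have notmem {f : R} (hp : (I.colon {f}).IsPrime) : z 0 ∉ I.colon {f} := by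
      intro hzp
      set p := I.colon {f} with hpdef
      have hIp : I ≤ p := fun i hi ↦ mem_colon_singleton_iff.2 (I.mul_mem_right _ hi)
      have hle : ((maximalIdeal R).map (Ideal.Quotient.mk p)).spanFinrank ≤ k := by
        have : (maximalIdeal R).map (Ideal.Quotient.mk p) =
            Ideal.span (Set.range fun i : Fin k ↦ Ideal.Quotient.mk p (z i.succ)) := by
          have hker : (I ⊔ Ideal.span {z 0}).map (Ideal.Quotient.mk p) = ⊥ := by
            rw [Ideal.map_eq_bot_iff_le_ker, Ideal.mk_ker]
            exact sup_le hIp ((Ideal.span_singleton_le_iff_mem _).2 hzp)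
          rw [hsplit, Ideal.map_sup, hker, bot_sup_eq, Ideal.map_span, ← Set.range_comp]
          rfl
        rw [this]
        refine (Submodule.spanFinrank_span_le_ncard_of_finite (Set.finite_range _)).trans ?_
        rw [← Set.image_univ]
        exact (Set.ncard_image_le Set.finite_univ).trans (by simp [Set.ncard_univ])
      have : Nontrivial (R ⧸ p) := Ideal.Quotient.nontrivial_iff.2 hp.ne_top
      have : IsLocalRing (R ⧸ p) := .of_surjective' _ Ideal.Quotient.mk_surjective
      have hmax : maximalIdeal (R ⧸ p) = (maximalIdeal R).map (Ideal.Quotient.mk p) :=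
        (IsLocalRing.map_maximalIdeal_of_surjective _ Ideal.Quotient.mk_surjective).symm
      have h3 := (le_ringKrullDim_quotient_colon h hp).trans
        (ringKrullDim_le_spanFinrank_maximalIdeal (R := R ⧸ p))
      rw [hmax] at h3
      have h4 : k + 1 ≤ ((maximalIdeal R).map (Ideal.Quotient.mk p)).spanFinrank := by
        exact_mod_cast h3
      omega
    have hreg : ∀ f, z 0 * f ∈ I → f ∈ I := by
      intro f hf
      by_contra hfI
      obtain ⟨g, hg, hle⟩ := exists_isPrime_colon_ge I hfI
      exact notmem hg (hle (mem_colon_singleton_iff.2 hf))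
    have hQ : (I ⊔ Ideal.span {z 0}).IsPrime :=
      ih (h.sup_span_singleton hz0 hreg) _ hsplit
    obtain ⟨p, hpmin, hpQ⟩ := Ideal.exists_minimalPrimes_le (I := I)
      (J := I ⊔ Ideal.span {z 0}) le_sup_left
    have hp : p.IsPrime := hpmin.1.1
    have hzp : z 0 ∉ p := by
      obtain ⟨g, hg⟩ := Submodule.exists_eq_colon_of_mem_minimalPrimes
        (N := I) (x := (1 : R)) (I := p) (by
          have : I.colon {(1 : R)} = I := by
            ext; simp
          rwa [this])
      rw [hg] at hp ⊢
      exact notmem hp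
    -- Since `p ⊆ I + (z 0)` and `z 0 ∉ p`, one gets `p ⊆ I + (z 0)p`, and Nakayama applies.
    have : p ≤ I := by
      refine Submodule.le_of_le_smul_of_le_jacobson_bot (I := maximalIdeal R) (N := I)
        (N' := p) (IsNoetherian.noetherian p) (maximalIdeal_le_jacobson _) ?_
      intro g hg
      obtain ⟨i, hi, j, hj, rfl⟩ := Submodule.mem_sup.1 (hpQ hg)
      obtain ⟨w, rfl⟩ := Ideal.mem_span_singleton'.1 hj
      refine Submodule.add_mem_sup hi ?_
      have hw : w * z 0 ∈ p := by
        have := p.sub_mem hg (hpmin.1.2 hi)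
        simpa using this
      rw [mul_comm]
      exact Submodule.smul_mem_smul hz0 ((hp.mem_or_mem hw).resolve_right hzp)
    rwa [le_antisymm hpmin.1.2 this]

end LocalAlgebra

/-! ### Regular sequences and dimension at closed points of affine space -/

section PolynomialRing

open IsLocalRing RingTheory.Sequence
open scoped Pointwise

universe u

theorem isWeaklyRegular_pair_iff {A : Type u} [CommRing A] (f g : A) :
    IsWeaklyRegular A [f, g] ↔
      (∀ h, f * h = 0 → h = 0) ∧ ∀ h, g * h ∈ Ideal.span {f} → h ∈ Ideal.span {f} := by
  rw [isWeaklyRegular_cons_iff, isWeaklyRegular_singleton_iff]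
  refine and_congr isSMulRegular_iff_right_eq_zero_of_smul ?_
  have h1 : f • (⊤ : Submodule A A) = Ideal.span {f} := by
    ext y
    simp [Submodule.mem_smul_pointwise_iff_exists, Ideal.mem_span_singleton', mul_comm]
  refine Iff.trans ?_ (isSMulRegular_quotient_iff (Ideal.span {f}) g)
  exact (Submodule.quotEquivOfEq _ _ h1).isSMulRegular_congr g

theorem ofList_pair {A : Type u} [CommRing A] (f g : A) :
    Ideal.ofList [f, g] = Ideal.span {f, g} := by
  rw [Ideal.ofList_cons, Ideal.ofList_singleton, Ideal.span_insert]

theorem isRegular_pair_of_ne_top {A : Type u} [CommRing A] {f g : A}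
    (h : IsWeaklyRegular A [f, g]) (hne : Ideal.span {f, g} ≠ ⊤) : IsRegular A [f, g] := by
  refine ⟨h, fun he ↦ hne ?_⟩
  rw [ofList_pair] at he
  simpa using he.symm

theorem span_pair_ne_top {A : Type u} [CommRing A] {f g : A}
    (h : IsRegular A [f, g]) : Ideal.span {f, g} ≠ ⊤ := fun he ↦ h.2 <| by
  rw [ofList_pair, he]; simp

variable {K : Type u} [Field K] {N : ℕ}

/-- The substitution of `cⱼ` for `xⱼ`, for all `j < i`. -/
def partialEval (c : Fin N → K) (i : ℕ) :
    MvPolynomial (Fin N) K →ₐ[K] MvPolynomial (Fin N) K :=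
  aeval fun j ↦ if (j : ℕ) < i then C (c j) else X j

/-- Substituting the first `i` coordinates of `c` kills exactly the first `i` elements, fixes the
next one, and takes values in a domain. -/
theorem isWeaklyRegular_X_sub_C (c : Fin N → K) :
    IsWeaklyRegular (MvPolynomial (Fin N) K) (List.ofFn fun j ↦ X j - C (c j)) := by
  rw [isWeaklyRegular_iff]
  intro i hi
  rw [List.length_ofFn] at hi
  have hel : ∀ (h : i < (List.ofFn fun j : Fin N ↦ X (R := K) j - C (c j)).length),
      (List.ofFn fun j : Fin N ↦ X (R := K) j - C (c j))[i] = X ⟨i, hi⟩ - C (c ⟨i, hi⟩) := by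
    simp
  rw [hel]
  set I := Ideal.ofList ((List.ofFn fun j : Fin N ↦ X (R := K) j - C (c j)).take i) with hI
  have hImem (j : Fin N) (hj : (j : ℕ) < i) : X (R := K) j - C (c j) ∈ I := by
    refine Ideal.subset_span ?_
    rw [Set.mem_ofPred_eq, List.mem_take_iff_getElem]
    exact ⟨j, by simp [hj], by simp⟩
  have hker : I ≤ RingHom.ker (partialEval c i) := by
    rw [hI, Ideal.ofList, Ideal.span_le]
    intro p hp
    rw [Set.mem_ofPred_eq, List.mem_take_iff_getElem] at hp
    obtain ⟨j, hj, rfl⟩ := hp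
    have hji : j < i := by omega
    simp [partialEval, RingHom.mem_ker, hji]
  have hsub (f : MvPolynomial (Fin N) K) : f - partialEval c i f ∈ I := by
    induction f using MvPolynomial.induction_on with
    | C a => simp [partialEval]
    | add p q hp hq => rw [map_add, add_sub_add_comm]; exact I.add_mem hp hq
    | mul_X p j hp =>
      have hX : X j - partialEval c i (X j) ∈ I := by
        by_cases hj : (j : ℕ) < i
        · simpa [partialEval, hj] using hImem j hj
        · simp [partialEval, hj]
      have : p * X j - partialEval c i (p * X j) =
          (p - partialEval c i p) * X j + partialEval c i p * (X j - partialEval c i (X j)) := by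
        rw [map_mul]; ring
      rw [this]
      exact I.add_mem (I.mul_mem_right _ hp) (I.mul_mem_left _ hX)
  have hIt : I • (⊤ : Submodule (MvPolynomial (Fin N) K) (MvPolynomial (Fin N) K)) = I := by simp
  rw [hIt, isSMulRegular_quotient_iff]
  intro f hf
  have h1 := RingHom.mem_ker.1 (hker hf)
  have h2 : partialEval c i (X ⟨i, hi⟩ - C (c ⟨i, hi⟩)) = X ⟨i, hi⟩ - C (c ⟨i, hi⟩) := by
    simp [partialEval]
  have h3 : X ⟨i, hi⟩ - C (c ⟨i, hi⟩) ≠ (0 : MvPolynomial (Fin N) K) := by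
    intro h
    have := congrArg (eval fun _ ↦ c ⟨i, hi⟩ + 1) h
    simp at this
  rw [map_mul, h2] at h1
  have h4 := (mul_eq_zero.1 h1).resolve_left h3
  simpa [h4] using hsub f

variable [IsAlgClosed K]

theorem exists_eq_vanishingIdeal (M : Ideal (MvPolynomial (Fin N) K)) [hM : M.IsMaximal] :
    ∃ c : Fin N → K, ∀ f, f ∈ M ↔ eval c f = 0 := by
  obtain ⟨c, hc⟩ := isMaximal_iff_eq_vanishingIdeal_singleton.1 hM
  refine ⟨c, fun f ↦ ?_⟩
  rw [hc, mem_vanishingIdeal_singleton_iff]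
  rfl

theorem hasRegularSeq_localization (M : Ideal (MvPolynomial (Fin N) K)) [hM : M.IsMaximal] :
    HasRegularSeq (Localization.AtPrime M) N (Localization.AtPrime M) := by
  obtain ⟨c, hc⟩ := exists_eq_vanishingIdeal M
  refine ⟨(List.ofFn fun j ↦ X j - C (c j)).map (algebraMap _ _), by simp, ?_, ?_⟩
  · intro r hr
    obtain ⟨f, hf, rfl⟩ := List.mem_map.1 hr
    obtain ⟨j, rfl⟩ := List.mem_ofFn.1 hf
    rw [IsLocalization.AtPrime.to_map_mem_maximal_iff _ M, hc]
    simp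
  · refine (isWeaklyRegular_X_sub_C c).isRegular_of_isLocalization_of_mem _ M ?_
    simp only [List.mem_ofFn, forall_exists_index, forall_apply_eq_imp_iff]
    intro j
    rw [hc]
    simp

theorem ringKrullDim_localization (M : Ideal (MvPolynomial (Fin N) K)) [hM : M.IsMaximal] :
    ringKrullDim (Localization.AtPrime M) = N := by
  apply le_antisymm
  · rw [IsLocalization.AtPrime.ringKrullDim_eq_height M]
    refine Ideal.height_le_ringKrullDim_of_isPrime.trans ?_
    rw [MvPolynomial.ringKrullDim_of_isNoetherianRing]
    simp
  · obtain ⟨rs, hl, -, hr⟩ := hasRegularSeq_localization M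
    have h := ringKrullDim_add_length_eq_ringKrullDim_of_isRegular rs hr
    rw [← h, hl]
    have : Nontrivial (Localization.AtPrime M ⧸ Ideal.ofList rs) := by
      rw [Ideal.Quotient.nontrivial_iff]
      intro he
      exact hr.2 (by simp [he])
    have := ringKrullDim_nonneg_of_nontrivial (R := Localization.AtPrime M ⧸ Ideal.ofList rs)
    exact le_add_of_nonneg_left this

theorem map_span_pair {A B : Type*} [CommRing A] [CommRing B] (φ : A →+* B) (f g : A) :
    (Ideal.span {f, g}).map φ = ⊥ ⊔ Ideal.span {φ f} ⊔ Ideal.span {φ g} := by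
  rw [Ideal.map_span, Set.image_pair, Ideal.span_insert, bot_sup_eq]

/-- Each of `f` and `g` costs one step of the coordinate sequence, though neither belongs to it. -/
theorem hasRegularSeq_localization_quotient {f g : MvPolynomial (Fin (N + 1 + 1)) K}
    (h : IsWeaklyRegular (MvPolynomial (Fin (N + 1 + 1)) K) [f, g])
    (M : Ideal (MvPolynomial (Fin (N + 1 + 1)) K)) [hM : M.IsMaximal]
    (hle : Ideal.span {f, g} ≤ M) :
    HasRegularSeq (Localization.AtPrime M) N
      (Localization.AtPrime M ⧸ (Ideal.span {f, g}).map
        (algebraMap _ (Localization.AtPrime M))) := by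
  have hmem (x : MvPolynomial (Fin (N + 1 + 1)) K) (hx : x ∈ M) :
      algebraMap _ (Localization.AtPrime M) x ∈ maximalIdeal (Localization.AtPrime M) := by
    rwa [IsLocalization.AtPrime.to_map_mem_maximal_iff _ M]
  have h' := h.of_isLocalization (Localization.AtPrime M) M.primeCompl
  rw [List.map_cons, List.map_cons, List.map_nil, isWeaklyRegular_pair_iff] at h'
  rw [map_span_pair]
  have h0 : HasRegularSeq (Localization.AtPrime M) (N + 1 + 1)
      (Localization.AtPrime M ⧸ (⊥ : Ideal (Localization.AtPrime M))) :=
    (hasRegularSeq_localization M).of_linearEquiv (Submodule.quotEquivOfEqBot ⊥ rfl).symm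
  refine (h0.sup_span_singleton (hmem f (hle (Ideal.subset_span (by simp)))) ?_).sup_span_singleton
    (hmem g (hle (Ideal.subset_span (by simp)))) ?_
  · simpa using h'.1
  · simpa using h'.2

end PolynomialRing

/-! ### Unmixedness, saturation and Cohen-Macaulayness in codimension two -/

section CompleteIntersection

open IsLocalRing RingTheory.Sequence
open scoped Pointwise

universe u

theorem colon_map_localization {A : Type u} [CommRing A] (M : Ideal A) [M.IsPrime] {I : Ideal A}
    {u : A} :
    (I.map (algebraMap A (Localization.AtPrime M))).colon
      {algebraMap A (Localization.AtPrime M) u} =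
        (I.colon {u}).map (algebraMap A (Localization.AtPrime M)) := by
  ext r
  obtain ⟨r, s, rfl⟩ := IsLocalization.exists_mk'_eq M.primeCompl r
  rw [mem_colon_singleton_iff, mul_comm, ← IsLocalization.mk'_one (M := M.primeCompl) _ u,
    ← IsLocalization.mk'_mul, IsLocalization.mk'_mem_map_algebraMap_iff,
    IsLocalization.mk'_mem_map_algebraMap_iff]
  simp only [mem_colon_singleton_iff]
  refine exists_congr fun t ↦ and_congr_right fun _ ↦ ?_
  rw [mul_assoc, mul_comm u]

/-- In the localization at `p` the pair stays regular and lowers the dimension by two, leaving a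
nonnegative dimension. -/
theorem two_le_height_of_isRegular {A : Type u} [CommRing A] [IsNoetherianRing A] {f g : A}
    (h : IsWeaklyRegular A [f, g]) {p : Ideal A} (hp : p.IsPrime) (hle : Ideal.span {f, g} ≤ p) :
    2 ≤ p.height := by
  have hreg := h.isRegular_of_isLocalization_of_mem (Localization.AtPrime p) p (by
    intro r hr
    refine hle (Ideal.subset_span ?_)
    simpa using hr)
  have hdim := ringKrullDim_add_length_eq_ringKrullDim_of_isRegular _ hreg
  rw [IsLocalization.AtPrime.ringKrullDim_eq_height p (Localization.AtPrime p)] at hdim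
  have : Nontrivial (Localization.AtPrime p ⧸
      Ideal.ofList ([f, g].map (algebraMap A (Localization.AtPrime p)))) := by
    rw [Ideal.Quotient.nontrivial_iff]
    intro he
    exact hreg.2 (by rw [he]; simp)
  have h2 := ringKrullDim_nonneg_of_nontrivial (R := Localization.AtPrime p ⧸
      Ideal.ofList ([f, g].map (algebraMap A (Localization.AtPrime p))))
  have h3 : ((2 : ℕ∞) : WithBot ℕ∞) ≤ p.height := by
    rw [← hdim]
    exact le_add_of_nonneg_left h2
  exact WithBot.coe_le_coe.1 h3

theorem eq_natCast_of_add_two_eq {d : WithBot ℕ∞} {k : ℕ}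
    (h : d + (2 : ℕ) = ((k + 1 + 1 : ℕ) : WithBot ℕ∞)) : d = k := by
  induction d with
  | bot => exact absurd h (WithBot.bot_ne_coe (a := ((k + 1 + 1 : ℕ) : ℕ∞)))
  | coe d =>
    have h1 : d + (2 : ℕ) = ((k + 1 + 1 : ℕ) : ℕ∞) := WithBot.coe_inj.1 h
    induction d with
    | top => exact absurd h1 (by simpa using (ENat.natCast_ne_top (k + 1 + 1)).symm)
    | coe d =>
      have h2 : d + 2 = k + 1 + 1 := by exact_mod_cast h1
      have h3 : d = k := by omega
      rw [h3]
      rfl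

theorem localDepth_eq_ringKrullDim {A : Type u} [CommRing A] [IsLocalRing A] [IsNoetherianRing A]
    {k : ℕ} (h : HasRegularSeq A k A) (hd : ringKrullDim A = k) :
    (localDepth A : WithBot ℕ∞) = ringKrullDim A := by
  rw [hd]
  refine congrArg _ (le_antisymm ?_ ?_ : localDepth A = (k : ℕ∞))
  · refine iSup_le fun rs ↦ iSup₂_le fun _ hr ↦ ?_
    have h1 := ringKrullDim_add_length_eq_ringKrullDim_of_isRegular rs hr
    have : Nontrivial (A ⧸ Ideal.ofList rs) := by
      rw [Ideal.Quotient.nontrivial_iff]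
      intro he
      exact hr.2 (by simp [he])
    have h2 := ringKrullDim_nonneg_of_nontrivial (R := A ⧸ Ideal.ofList rs)
    have h3 : (rs.length : WithBot ℕ∞) ≤ k := by
      rw [← hd, ← h1]
      exact le_add_of_nonneg_left h2
    exact_mod_cast h3
  · obtain ⟨rs, hl, hm, hr⟩ := h
    rw [← hl]
    exact le_iSup_of_le rs (le_iSup₂_of_le hm hr le_rfl)

theorem HasRegularSeq.of_quotient_ringEquiv {A B : Type u} [CommRing A] [IsLocalRing A] [CommRing B]
    [IsLocalRing B] {k : ℕ} {I : Ideal A} (h : HasRegularSeq A k (A ⧸ I)) (e : A ⧸ I ≃+* B) :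
    HasRegularSeq B k B := by
  obtain ⟨rs, hl, hm, hr⟩ := h
  refine ⟨rs.map ((e : A ⧸ I →+* B).comp (Ideal.Quotient.mk I)), by simpa using hl, ?_, ?_⟩
  · intro r hr'
    obtain ⟨x, hx, rfl⟩ := List.mem_map.1 hr'
    have hsurj : Function.Surjective ((e : A ⧸ I →+* B).comp (Ideal.Quotient.mk I)) :=
      e.surjective.comp Ideal.Quotient.mk_surjective
    have := hsurj.isLocalHom
    exact map_nonunit _ x (hm x hx)
  · refine (AddEquiv.isRegular_congr (e := e.toAddEquiv) ?_).1 hr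
    refine List.forall₂_map_right_iff.2 (List.forall₂_same.2 fun r _ x ↦ ?_)
    obtain ⟨x, rfl⟩ := Ideal.Quotient.mk_surjective x
    exact map_mul e (Ideal.Quotient.mk I r) (Ideal.Quotient.mk I x)

/-- Localization commutes with passing to the quotient. -/
def localizationQuotientEquiv {A : Type u} [CommRing A] (I : Ideal A) (M : Ideal (A ⧸ I))
    [M.IsPrime] :
    Localization.AtPrime (M.comap (Ideal.Quotient.mk I)) ⧸
      I.map (algebraMap A (Localization.AtPrime (M.comap (Ideal.Quotient.mk I)))) ≃+*
      Localization.AtPrime M := by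
  have hsub : Algebra.algebraMapSubmonoid (A ⧸ I)
      (M.comap (Ideal.Quotient.mk I)).primeCompl = M.primeCompl := by
    ext x
    constructor
    · rintro ⟨y, hy, rfl⟩
      exact hy
    · obtain ⟨y, rfl⟩ := Ideal.Quotient.mk_surjective x
      exact fun hy ↦ ⟨y, hy, rfl⟩
  have : IsLocalization M.primeCompl (Localization.AtPrime (M.comap (Ideal.Quotient.mk I)) ⧸
      I.map (algebraMap A (Localization.AtPrime (M.comap (Ideal.Quotient.mk I))))) := by
    rw [← hsub]
    infer_instance
  exact (IsLocalization.algEquiv M.primeCompl _ _).toRingEquiv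

variable {K : Type u} [Field K] {N : ℕ}

theorem mem_saturation_iff {n : ℕ} {I : Ideal (MvPolynomial (Fin (n + 1)) K)}
    {u : MvPolynomial (Fin (n + 1)) K} :
    u ∈ saturation I ↔ ∃ k : ℕ, ∀ v ∈ idealOfVars (Fin (n + 1)) K ^ k, u * v ∈ I := by
  rw [saturation, Submodule.mem_iSup_of_directed]
  · simp [Submodule.mem_colon]
  · refine Monotone.directed_le fun i j hij ↦ Submodule.colon_mono le_rfl ?_
    exact Ideal.pow_le_pow_right hij

variable [IsAlgClosed K]

/-- The unmixedness theorem for complete intersections of codimension two. -/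
theorem height_colon_le_two {f g : MvPolynomial (Fin (N + 1 + 1)) K}
    (h : IsWeaklyRegular (MvPolynomial (Fin (N + 1 + 1)) K) [f, g])
    {u : MvPolynomial (Fin (N + 1 + 1)) K} (hp : ((Ideal.span {f, g}).colon {u}).IsPrime) :
    ((Ideal.span {f, g}).colon {u}).height ≤ 2 := by
  set p := (Ideal.span {f, g}).colon {u} with hpdef
  obtain ⟨M, hM, hpM⟩ := Ideal.exists_le_maximal p hp.ne_top
  have hI : Ideal.span {f, g} ≤ M :=
    le_trans (fun i hi ↦ mem_colon_singleton_iff.2 (Ideal.mul_mem_right _ _ hi)) hpM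
  have hdisj : Disjoint (M.primeCompl : Set (MvPolynomial (Fin (N + 1 + 1)) K)) p :=
    Set.disjoint_left.2 fun x hx hxp ↦ hx (hpM hxp)
  have hcolon := colon_map_localization M (I := Ideal.span {f, g}) (u := u)
  have hp' : (p.map (algebraMap _ (Localization.AtPrime M))).IsPrime :=
    IsLocalization.isPrime_of_isPrime_disjoint M.primeCompl _ p hp hdisj
  -- At a closed point of `V(p)` the ambient dimension is `N + 2` and the quotient has depth at
  -- least `N`, which leaves at most 2 for the height.
  have key := height_colon_add_le (hasRegularSeq_localization_quotient h M hI)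
    (f := algebraMap _ (Localization.AtPrime M) u) (by rw [hcolon]; exact hp')
  rw [hcolon, IsLocalization.height_map_of_disjoint M.primeCompl p hdisj,
    ringKrullDim_localization] at key
  have key' : p.height + N ≤ 2 + N := by
    have : ((p.height + N : ℕ∞) : WithBot ℕ∞) ≤ ((2 + N : ℕ∞) : WithBot ℕ∞) := by
      have h2 : (2 + N : ℕ∞) = ((N + 1 + 1 : ℕ) : ℕ∞) := by
        push_cast
        rw [add_assoc, one_add_one_eq_two, add_comm]
      rw [h2]
      exact key
    exact WithBot.coe_le_coe.1 this
  exact (ENat.add_le_add_iff_right (ENat.natCast_ne_top N)).1 key'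

theorem height_eq_of_isMaximal (M : Ideal (MvPolynomial (Fin N) K)) [hM : M.IsMaximal] :
    M.height = N := by
  have := ringKrullDim_localization M
  rw [IsLocalization.AtPrime.ringKrullDim_eq_height M] at this
  exact_mod_cast this

theorem height_of_idealOfVars_le {p : Ideal (MvPolynomial (Fin N) K)} (hp : p.IsPrime)
    (hle : idealOfVars (Fin N) K ≤ p) : p.height = N := by
  obtain ⟨M, hM, hpM⟩ := Ideal.exists_le_maximal p hp.ne_top
  obtain ⟨c, hc⟩ := exists_eq_vanishingIdeal M
  have hc0 : c = 0 := by
    ext j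
    have : X j ∈ M := hpM (hle (Ideal.subset_span ⟨j, rfl⟩))
    simpa [hc] using this
  have : M = p := by
    refine le_antisymm (fun f hf ↦ hle ?_) hpM
    rw [← pow_one (idealOfVars (Fin N) K), mem_pow_idealOfVars_iff']
    intro x hx
    have hx0 : x = 0 := by
      rw [← Finsupp.degree_eq_zero_iff]; omega
    rw [hc, hc0] at hf
    rw [hx0, ← constantCoeff_eq, ← eval_zero]
    exact hf
  rw [← this]
  exact height_eq_of_isMaximal M

/-- The condition `n ≥ 2` enters here: there are at least three variables. -/
theorem not_idealOfVars_le_of_height_le_two {p : Ideal (MvPolynomial (Fin (N + 1 + 1 + 1)) K)}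
    (hp : p.IsPrime) (h : p.height ≤ 2) : ¬ idealOfVars (Fin (N + 1 + 1 + 1)) K ≤ p := by
  intro hle
  rw [height_of_idealOfVars_le hp hle] at h
  have : N + 1 + 1 + 1 ≤ 2 := by exact_mod_cast h
  omega

/-- Otherwise an associated prime of `(f, g)` would contain a power of `𝔪`, against unmixedness. -/
theorem mem_span_pair_of_forall_mul_mem {f g : MvPolynomial (Fin (N + 1 + 1 + 1)) K}
    (h : IsWeaklyRegular (MvPolynomial (Fin (N + 1 + 1 + 1)) K) [f, g])
    {u : MvPolynomial (Fin (N + 1 + 1 + 1)) K} {k : ℕ}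
    (hu : ∀ v ∈ idealOfVars (Fin (N + 1 + 1 + 1)) K ^ k, u * v ∈ Ideal.span {f, g}) :
    u ∈ Ideal.span {f, g} := by
  by_contra huI
  obtain ⟨w, hw, hle⟩ := exists_isPrime_colon_ge _ huI
  refine not_idealOfVars_le_of_height_le_two hw (height_colon_le_two h hw) ?_
  refine hw.le_of_pow_le (n := k) fun v hv ↦ hle (mem_colon_singleton_iff.2 ?_)
  rw [mul_comm]
  exact hu v hv

theorem saturation_span_pair {f g : MvPolynomial (Fin (N + 1 + 1 + 1)) K}
    (h : IsWeaklyRegular (MvPolynomial (Fin (N + 1 + 1 + 1)) K) [f, g]) :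
    saturation (Ideal.span {f, g}) = Ideal.span {f, g} := by
  ext u
  rw [mem_saturation_iff]
  exact ⟨fun ⟨k, hk⟩ ↦ mem_span_pair_of_forall_mul_mem h hk,
    fun hu ↦ ⟨0, fun v _ ↦ Ideal.mul_mem_right _ _ hu⟩⟩

theorem isCohenMacaulay_quotient_span_pair {f g : MvPolynomial (Fin (N + 1 + 1)) K}
    (h : IsWeaklyRegular (MvPolynomial (Fin (N + 1 + 1)) K) [f, g]) :
    IsCohenMacaulay (MvPolynomial (Fin (N + 1 + 1)) K ⧸ Ideal.span {f, g}) := by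
  set I := Ideal.span {f, g}
  refine ⟨inferInstance, ?_⟩
  intro M' hM'
  set M := M'.comap (Ideal.Quotient.mk I)
  have hM : M.IsMaximal := Ideal.comap_isMaximal_of_surjective _ Ideal.Quotient.mk_surjective
  have hIM : I ≤ M := fun x hx ↦ by
    rw [Ideal.mem_comap, Ideal.Quotient.eq_zero_iff_mem.2 hx]
    exact M'.zero_mem
  have e := localizationQuotientEquiv I M'
  refine localDepth_eq_ringKrullDim
    ((hasRegularSeq_localization_quotient h M hIM).of_quotient_ringEquiv e) ?_
  rw [← ringKrullDim_eq_of_ringEquiv e]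
  have hreg := h.isRegular_of_isLocalization_of_mem (Localization.AtPrime M) M (by
    intro r hr
    refine hIM (Ideal.subset_span ?_)
    simpa using hr)
  have hdim := ringKrullDim_add_length_eq_ringKrullDim_of_isRegular _ hreg
  rw [List.map_cons, List.map_cons, List.map_nil, ofList_pair, ← Set.image_pair, ← Ideal.map_span,
    ringKrullDim_localization] at hdim
  generalize ringKrullDim (Localization.AtPrime M ⧸
    I.map (algebraMap _ (Localization.AtPrime M))) = d at hdim ⊢
  exact eq_natCast_of_add_two_eq hdim

theorem isACM_span_pair {d : ℕ} {f g : MvPolynomial (Fin (N + 1 + 1 + 1)) K}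
    (hf : f.IsHomogeneous d) (hg : g.IsHomogeneous d)
    (h : IsWeaklyRegular (MvPolynomial (Fin (N + 1 + 1 + 1)) K) [f, g]) :
    IsACM (n := N + 1 + 1) (Ideal.span {f, g}) := by
  refine ⟨fun u hu k ↦ ?_, saturation_span_pair h, isCohenMacaulay_quotient_span_pair h⟩
  let := gradedAlgebra (σ := Fin (N + 1 + 1 + 1)) (R := K)
  have : (Ideal.span {f, g}).IsHomogeneous (homogeneousSubmodule (Fin (N + 1 + 1 + 1)) K) := by
    refine Ideal.homogeneous_span _ _ ?_
    rintro x (rfl | rfl)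
    exacts [⟨d, hf⟩, ⟨d, hg⟩]
  rw [← decomposition.decompose'_apply]
  exact this k hu

end CompleteIntersection

/-! ### The Jacobian criterion and radicality -/

section Smooth

open IsLocalRing RingTheory.Sequence

universe u

variable {K : Type u} [Field K] {N : ℕ}

/-- The linear form with coefficients `w` in the coordinates centred at `c`. -/
def linearForm (c : Fin N → K) : (Fin N → K) →ₗ[K] MvPolynomial (Fin N) K :=
  Fintype.linearCombination K fun k ↦ X k - C (c k)

theorem linearForm_apply (c w : Fin N → K) :
    linearForm c w = ∑ k, C (w k) * (X k - C (c k)) := by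
  simp [linearForm, Fintype.linearCombination_apply, smul_eq_C_mul]

theorem eval_linearForm (c w : Fin N → K) : eval c (linearForm c w) = 0 := by
  simp [linearForm_apply]

/-- Taylor's formula of order one. -/
theorem sub_linearForm_mem_sq (c : Fin N → K) {M : Ideal (MvPolynomial (Fin N) K)}
    (hM : ∀ f, f ∈ M ↔ eval c f = 0) (f : MvPolynomial (Fin N) K) :
    f - C (eval c f) - linearForm c (fun k ↦ eval c (pderiv k f)) ∈ M ^ 2 := by
  induction f using MvPolynomial.induction_on with
  | C a => simp [linearForm_apply]
  | add p q hp hq =>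
    convert (M ^ 2).add_mem hp hq using 1
    have : (fun k ↦ eval c (pderiv k (p + q))) =
      (fun k ↦ eval c (pderiv k p)) + fun k ↦ eval c (pderiv k q) := by ext; simp
    rw [this, map_add, map_add, map_add]
    ring
  | mul_X p j hp =>
    -- The remainder of `p * X j` is the remainder of `p` times `X j`, plus this product of two
    -- elements of `M`.
    have h1 : linearForm c (fun k ↦ eval c (pderiv k p)) * (X j - C (c j)) ∈ M ^ 2 := by
      rw [sq]
      exact Ideal.mul_mem_mul ((hM _).2 (eval_linearForm _ _)) ((hM _).2 (by simp))
    convert (M ^ 2).add_mem h1 ((M ^ 2).mul_mem_right (X j) hp) using 1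
    have : (fun k ↦ eval c (pderiv k (p * X j))) =
        c j • (fun k ↦ eval c (pderiv k p)) + eval c p • Pi.single j 1 := by
      ext k
      by_cases hkj : k = j
      · subst hkj
        simp [mul_comm, add_comm]
      · simp [pderiv_X_of_ne (Ne.symm hkj), hkj, mul_comm]
    have h2 : linearForm c (Pi.single j 1) = X j - C (c j) := by
      simp [linearForm_apply, Pi.single_apply]
    rw [this, map_add, map_smul, map_smul, h2, smul_eq_C_mul, smul_eq_C_mul, map_mul, map_mul,
      eval_X]
    ring

theorem linearIndependent_of_isSmoothCutOut {n : ℕ} {f g : MvPolynomial (Fin (n + 1)) K}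
    (hZ : IsSmoothCutOut ![f, g]) {c : Fin (n + 1) → K} (hc : c ≠ 0) (hf : eval c f = 0)
    (hg : eval c g = 0) :
    LinearIndependent K ![fun k ↦ eval c (pderiv k f), fun k ↦ eval c (pderiv k g)] := by
  convert hZ c hc (by intro i; fin_cases i <;> simpa) using 1
  ext i k
  fin_cases i <;> rfl

variable [IsAlgClosed K]

/-- The Jacobian criterion for a complete intersection of codimension two. -/
theorem isPrime_map_span_pair {f g : MvPolynomial (Fin (N + 1 + 1)) K}
    (h : IsWeaklyRegular (MvPolynomial (Fin (N + 1 + 1)) K) [f, g]) {c : Fin (N + 1 + 1) → K}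
    (M : Ideal (MvPolynomial (Fin (N + 1 + 1)) K)) [M.IsMaximal]
    (hM : ∀ f, f ∈ M ↔ eval c f = 0) (hf : eval c f = 0) (hg : eval c g = 0)
    (hlin : LinearIndependent K
      ![fun k ↦ eval c (pderiv k f), fun k ↦ eval c (pderiv k g)]) :
    ((Ideal.span {f, g}).map (algebraMap _ (Localization.AtPrime M))).IsPrime := by
  have hIM : Ideal.span {f, g} ≤ M := by
    rw [Ideal.span_le]
    rintro x (rfl | rfl)
    exacts [(hM _).2 hf, (hM _).2 hg]
  set W := Submodule.span K (Set.range
    ![fun k ↦ eval c (pderiv k f), fun k ↦ eval c (pderiv k g)]) with hW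
  -- The gradients span a plane. A basis of a complement supplies `N` linear forms which, with `f`
  -- and `g`, generate `M` modulo `M ^ 2`, and Nakayama then gives generators of the local maximal
  -- ideal.
  obtain ⟨W', hW'⟩ := Submodule.exists_isCompl W
  have hrank : Module.finrank K W' = N := by
    have h1 := Submodule.finrank_add_eq_of_isCompl hW'
    rw [hW, finrank_span_eq_card hlin, Module.finrank_fin_fun] at h1
    simp at h1
    omega
  set w : Fin N → Fin (N + 1 + 1) → K :=
    fun i ↦ (Module.finBasisOfFinrankEq K W' hrank i : Fin (N + 1 + 1) → K) with hw
  have hspan : Submodule.span K (Set.range w) = W' := by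
    have := (Module.finBasisOfFinrankEq K W' hrank).span_eq
    have h2 := congrArg (Submodule.map W'.subtype) this
    rw [Submodule.map_span, ← Set.range_comp, Submodule.map_top, Submodule.range_subtype] at h2
    exact h2
  set Q₀ : Ideal (MvPolynomial (Fin (N + 1 + 1)) K) :=
    Ideal.span {f, g} ⊔ Ideal.span (Set.range fun i ↦ linearForm c (w i)) with hQ₀
  have hmem : ∀ v, linearForm c v ∈ Q₀ ⊔ M ^ 2 := by
    have key : (⊤ : Submodule K (Fin (N + 1 + 1) → K)) ≤
        ((Q₀ ⊔ M ^ 2).restrictScalars K).comap (linearForm c) := by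
      rw [← hW'.sup_eq_top, hW, ← hspan, sup_le_iff, Submodule.span_le, Submodule.span_le]
      have aux (p : MvPolynomial (Fin (N + 1 + 1)) K) (hp : p ∈ Ideal.span {f, g})
          (hp0 : eval c p = 0) :
          linearForm c (fun k ↦ eval c (pderiv k p)) ∈ Q₀ ⊔ M ^ 2 := by
        have h1 := sub_linearForm_mem_sq c hM p
        rw [hp0, map_zero, sub_zero] at h1
        have h2 := (Q₀ ⊔ M ^ 2).sub_mem
          (Ideal.mem_sup_left (Ideal.mem_sup_left hp)) (Ideal.mem_sup_right h1)
        simpa using h2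
      constructor
      · rintro _ ⟨i, rfl⟩
        fin_cases i
        · exact aux f (Ideal.subset_span (by simp)) hf
        · exact aux g (Ideal.subset_span (by simp)) hg
      · rintro _ ⟨i, rfl⟩
        exact Ideal.mem_sup_left (Ideal.mem_sup_right (Ideal.subset_span ⟨i, rfl⟩))
    exact fun v ↦ key (Submodule.mem_top (x := v))
  have hMle : M ≤ Q₀ ⊔ M ^ 2 := by
    intro p hp
    have h1 := sub_linearForm_mem_sq c hM p
    rw [(hM p).1 hp, map_zero, sub_zero] at h1
    have h2 := (Q₀ ⊔ M ^ 2).add_mem (Ideal.mem_sup_right h1)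
      (hmem fun k ↦ eval c (pderiv k p))
    simpa using h2
  have hQM : Q₀ ≤ M := by
    refine sup_le hIM (Ideal.span_le.2 ?_)
    rintro _ ⟨i, rfl⟩
    exact (hM _).2 (eval_linearForm _ _)
  refine isPrime_of_hasRegularSeq_of_generators
    (hasRegularSeq_localization_quotient h M hIM)
    (fun i ↦ algebraMap _ _ (linearForm c (w i))) ?_
  have hmap : Q₀.map (algebraMap _ (Localization.AtPrime M)) =
      (Ideal.span {f, g}).map (algebraMap _ (Localization.AtPrime M)) ⊔
      Ideal.span (Set.range fun i ↦ algebraMap _ (Localization.AtPrime M)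
        (linearForm c (w i))) := by
    rw [hQ₀, Ideal.map_sup, Ideal.map_span (algebraMap _ _) (Set.range _), ← Set.range_comp]
    rfl
  rw [← hmap, ← Localization.AtPrime.map_eq_maximalIdeal]
  refine le_antisymm ?_ (Ideal.map_mono hQM)
  refine Submodule.le_of_le_smul_of_le_jacobson_bot (I := maximalIdeal (Localization.AtPrime M))
    (IsNoetherian.noetherian _) (maximalIdeal_le_jacobson _) ?_
  refine (Ideal.map_mono hMle).trans ?_
  rw [Ideal.map_sup, sq, Ideal.map_mul, Localization.AtPrime.map_eq_maximalIdeal, smul_eq_mul]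

theorem exists_mem_zeroLocus_ne_zero {n : ℕ} {p : Ideal (MvPolynomial (Fin n) K)}
    (hp : p.IsPrime) (hle : ¬ idealOfVars (Fin n) K ≤ p) :
    ∃ c : Fin n → K, c ≠ 0 ∧ ∀ f ∈ p, eval c f = 0 := by
  obtain ⟨j, hj⟩ : ∃ j, X j ∉ p := by
    by_contra! hcon
    exact hle (Ideal.span_le.2 (by rintro _ ⟨j, rfl⟩; exact hcon j))
  rw [← IsPrime.vanishingIdeal_zeroLocus (K := K) p, mem_vanishingIdeal_iff] at hj
  push Not at hj
  obtain ⟨c, hc, hcj⟩ := hj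
  refine ⟨c, fun h ↦ hcj (by simp [h]), fun f hf ↦ hc f hf⟩

/-- If `u` is nilpotent modulo the ideal but not in it, `I : u` lies in an associated prime with a
zero `c ≠ 0`. The localized ideal at `c` is prime, so some `s` with `s(c) ≠ 0` satisfies `su ∈ I`,
although such an `s` must vanish at `c`. -/
theorem isRadical_span_pair {f g : MvPolynomial (Fin (N + 1 + 1 + 1)) K}
    (h : IsWeaklyRegular (MvPolynomial (Fin (N + 1 + 1 + 1)) K) [f, g])
    (hZ : IsSmoothCutOut (n := N + 1 + 1) ![f, g]) : (Ideal.span {f, g}).IsRadical := by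
  rintro u ⟨k, hk⟩
  by_contra hu
  obtain ⟨w, hw, hle⟩ := exists_isPrime_colon_ge _ hu
  obtain ⟨c, hc0, hc⟩ := exists_mem_zeroLocus_ne_zero hw
    (not_idealOfVars_le_of_height_le_two hw (height_colon_le_two h hw))
  have hI (p) (hp : p ∈ Ideal.span {f, g}) : eval c p = 0 :=
    hc p (mem_colon_singleton_iff.2 (Ideal.mul_mem_right _ _ hp))
  have hf := hI f (Ideal.subset_span (by simp))
  have hg := hI g (Ideal.subset_span (by simp))
  set M : Ideal (MvPolynomial (Fin (N + 1 + 1 + 1)) K) := vanishingIdeal K {c} with hMdef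
  have : M.IsMaximal := isMaximal_iff_eq_vanishingIdeal_singleton.2 ⟨c, rfl⟩
  have hM : ∀ p, p ∈ M ↔ eval c p = 0 := fun p ↦ mem_vanishingIdeal_singleton_iff c p
  have hprime := isPrime_map_span_pair h M hM hf hg
    (linearIndependent_of_isSmoothCutOut hZ hc0 hf hg)
  have hmem : algebraMap _ (Localization.AtPrime M) u ∈
      (Ideal.span {f, g}).map (algebraMap _ (Localization.AtPrime M)) := by
    refine hprime.mem_of_pow_mem k ?_
    rw [← map_pow]
    exact Ideal.mem_map_of_mem _ hk
  obtain ⟨s, hs, hsu⟩ := (IsLocalization.algebraMap_mem_map_algebraMap_iff M.primeCompl _ _ _).1 hmem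
  exact hs ((hM s).2 (hc s (hle (mem_colon_singleton_iff.2 hsu))))

end Smooth

/-! ### The pencil, its cofactor sums and the Jacobian ideal -/

section Pencil

open RingTheory.Sequence

universe u

theorem isUnit_of_dvd_of_isRegular_pair {A : Type u} [CommRing A] [IsDomain A] {f g x : A}
    (h : IsWeaklyRegular A [f, g]) (hf : x ∣ f) (hg : x ∣ g) : IsUnit x := by
  rw [isWeaklyRegular_pair_iff] at h
  obtain ⟨f', rfl⟩ := hf
  obtain ⟨g', rfl⟩ := hg
  -- With `f = x f'` and `g = x g'`, one has `g f' = g' f`.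
  have h1 : f' ∈ Ideal.span {x * f'} :=
    h.2 f' (Ideal.mem_span_singleton.2 ⟨g', by ring⟩)
  obtain ⟨t, ht⟩ := Ideal.mem_span_singleton.1 h1
  have hne : f' ≠ 0 := fun h0 ↦ one_ne_zero (h.1 1 (by simp [h0]))
  refine IsUnit.of_mul_eq_one t (mul_left_cancel₀ hne ?_)
  rw [mul_one]
  conv_rhs => rw [ht]
  ring

theorem isWeaklyRegular_pair_of_isRelPrime {A : Type u} [CommRing A] [IsDomain A]
    [UniqueFactorizationMonoid A] {f g : A} (hf : f ≠ 0) (h : IsRelPrime f g) :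
    IsWeaklyRegular A [f, g] := by
  rw [isWeaklyRegular_pair_iff]
  refine ⟨fun x hx ↦ (mul_eq_zero.1 hx).resolve_left hf, fun x hx ↦ ?_⟩
  rw [Ideal.mem_span_singleton] at hx ⊢
  let := UniqueFactorizationMonoid.toGCDMonoid A
  exact h.dvd_of_dvd_mul_left hx

theorem derivation_prod {K A ι : Type*} [CommRing K] [CommRing A] [Algebra K A]
    [DecidableEq ι] (D : Derivation K A A) (t : Finset ι) (G : ι → A) :
    D (∏ i ∈ t, G i) = ∑ i ∈ t, (∏ j ∈ t.erase i, G j) * D (G i) := by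
  induction t using Finset.induction_on with
  | empty => simp
  | insert a t ha ih =>
    rw [Finset.prod_insert ha, D.leibniz, ih, Finset.sum_insert ha, Finset.erase_insert ha,
      smul_eq_mul, smul_eq_mul, Finset.mul_sum, add_comm]
    congr 1
    refine Finset.sum_congr rfl fun i hi ↦ ?_
    have hia : i ≠ a := fun h ↦ ha (h ▸ hi)
    rw [Finset.erase_insert_of_ne hia.symm, Finset.prod_insert (by simp [ha]), mul_assoc]

variable {K : Type u} [Field K] {n s d : ℕ} {F P : MvPolynomial (Fin (n + 1)) K}
  {a b : Fin s → K} {G : Fin s → MvPolynomial (Fin (n + 1)) K}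

theorem pderiv_prod_eq (hG : ∀ i, G i = C (a i) * F + C (b i) * P) (k : Fin (n + 1)) :
    pderiv k (∏ i, G i) =
      weightedCofactorSum a G * pderiv k F + weightedCofactorSum b G * pderiv k P := by
  rw [derivation_prod, weightedCofactorSum, weightedCofactorSum, Finset.sum_mul, Finset.sum_mul,
    ← Finset.sum_add_distrib]
  refine Finset.sum_congr rfl fun i _ ↦ ?_
  have : pderiv k (G i) = C (a i) * pderiv k F + C (b i) * pderiv k P := by
    rw [hG i, map_add, pderiv_C_mul, pderiv_C_mul]
  rw [this]
  ring

/-- Each `(aᵢF + bᵢP) ∏_{j≠i} Gⱼ` is the full product. In characteristic zero the factor `s` is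
harmless, so common zeros of `H₁` and `H₂` lie on `G = 0`. -/
theorem weightedCofactorSum_mul_add (hG : ∀ i, G i = C (a i) * F + C (b i) * P) :
    weightedCofactorSum a G * F + weightedCofactorSum b G * P = (s : MvPolynomial _ K) * ∏ i, G i := by
  rw [weightedCofactorSum, weightedCofactorSum, Finset.sum_mul, Finset.sum_mul,
    ← Finset.sum_add_distrib]
  trans ∑ i : Fin s, ∏ j, G j
  · refine Finset.sum_congr rfl fun i _ ↦ ?_
    rw [← Finset.mul_prod_erase _ G (Finset.mem_univ i), hG i]
    ring
  · simp

theorem isHomogeneous_weightedCofactorSum (c : Fin s → K) (h : ∀ i, (G i).IsHomogeneous d) :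
    (weightedCofactorSum c G).IsHomogeneous ((s - 1) * d) := by
  refine IsHomogeneous.sum _ _ _ fun i _ ↦ ?_
  have h1 := IsHomogeneous.prod (Finset.univ.erase i) G (fun _ ↦ d) fun j _ ↦ h j
  rw [Finset.sum_const, Finset.card_erase_of_mem (Finset.mem_univ i), Finset.card_univ,
    Fintype.card_fin, smul_eq_mul] at h1
  exact h1.C_mul _

theorem weightedCofactorSum_mem {I : Ideal (MvPolynomial (Fin (n + 1)) K)} (hs : 2 ≤ s)
    (c : Fin s → K) (h : ∀ i, G i ∈ I) : weightedCofactorSum c G ∈ I := by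
  refine I.sum_mem fun i _ ↦ I.mul_mem_left _ ?_
  have : Nontrivial (Fin s) := Fin.nontrivial_iff_two_le.2 hs
  obtain ⟨j, hj⟩ := exists_ne i
  rw [← Finset.mul_prod_erase _ G (Finset.mem_erase.2 ⟨hj, Finset.mem_univ j⟩)]
  exact I.mul_mem_right _ (h j)

/-- Only the `i`-th cofactor omits the factor `Gᵢ`. -/
theorem map_weightedCofactorSum {A : Type*} [CommRing A]
    (φ : MvPolynomial (Fin (n + 1)) K →+* A) (c : Fin s → K) {i : Fin s} (hi : φ (G i) = 0) :
    φ (weightedCofactorSum c G) = φ (C (c i)) * ∏ j ∈ Finset.univ.erase i, φ (G j) := by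
  rw [weightedCofactorSum, map_sum, Finset.sum_eq_single i]
  · rw [map_mul, map_prod]
  · intro k _ hk
    rw [map_mul, map_prod, Finset.prod_eq_zero (Finset.mem_erase.2 ⟨hk.symm, Finset.mem_univ i⟩) hi,
      mul_zero]
  · simp

theorem ne_zero_of_isSmoothCutOut {f : MvPolynomial (Fin (n + 1)) K}
    (h : IsSmoothCutOut ![f]) : f ≠ 0 := by
  rintro rfl
  have h1 := h (fun _ ↦ 1) (fun h ↦ one_ne_zero (congrFun h 0)) (by simp)
  exact h1.ne_zero 0 (by ext; simp)

theorem pencil_coeff_ne_zero (hG : ∀ i, G i = C (a i) * F + C (b i) * P)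
    (hne : ∀ i, G i ≠ 0) (i : Fin s) : a i ≠ 0 ∨ b i ≠ 0 := by
  by_contra! h
  exact hne i (by simp [hG, h.1, h.2])

/-- Proportional coefficient vectors would give associated members. -/
theorem pencil_det_ne_zero (hG : ∀ i, G i = C (a i) * F + C (b i) * P)
    (hne : ∀ i, G i ≠ 0) (hdist : ∀ i j, i ≠ j → ¬ Associated (G i) (G j)) {i j : Fin s}
    (hij : i ≠ j) : a i * b j - a j * b i ≠ 0 := by
  intro h
  have key : ∃ c : K, a j = c * a i ∧ b j = c * b i := by
    rcases pencil_coeff_ne_zero hG hne i with hi | hi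
    · exact ⟨a j / a i, by field_simp, by field_simp; linear_combination h⟩
    · exact ⟨b j / b i, by field_simp; linear_combination -h, by field_simp⟩
  obtain ⟨c, h1, h2⟩ := key
  have hGj : G j = C c * G i := by
    rw [hG, hG, h1, h2, C_mul, C_mul]
    ring
  have hc : c ≠ 0 := by
    rintro rfl
    exact hne j (by simp [hGj])
  refine hdist i j hij ?_
  rw [hGj]
  rw [mul_comm]
  exact (associated_mul_unit_left _ _ ((isUnit_iff_ne_zero.2 hc).map C)).symm

/-- The base locus of a pencil is cut out by any two distinct members. -/
theorem map_eq_zero_of_map_pencil_eq_zero (hG : ∀ i, G i = C (a i) * F + C (b i) * P)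
    {A : Type*} [CommRing A] [IsDomain A] (φ : MvPolynomial (Fin (n + 1)) K →+* A) {i j : Fin s}
    (hdet : a i * b j - a j * b i ≠ 0) (hi : φ (G i) = 0) (hj : φ (G j) = 0) :
    φ F = 0 ∧ φ P = 0 := by
  have hC : φ (C (a i * b j - a j * b i)) ≠ 0 := by
    intro h
    exact hdet ((φ.comp C).injective (by simpa using h))
  have h1 : φ (C (a i * b j - a j * b i) * F) = φ (C (b j) * G i - C (b i) * G j) := by
    rw [hG, hG]
    congr 1
    simp only [C_sub, C_mul]
    ring
  have h2 : φ (C (a i * b j - a j * b i) * P) = φ (C (a i) * G j - C (a j) * G i) := by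
    rw [hG, hG]
    congr 1
    simp only [C_sub, C_mul]
    ring
  rw [map_mul, map_sub φ, map_mul φ _ (G _), map_mul φ _ (G _), hi, hj, mul_zero, mul_zero,
    sub_zero] at h1 h2
  exact ⟨(mul_eq_zero.1 h1).resolve_left hC, (mul_eq_zero.1 h2).resolve_left hC⟩

/-- Some `Gᵢ` dies because `sG` does. Then `H₁` and `H₂` become `aᵢ` and `bᵢ` times the product of
the others, so a second member dies. A general domain as target lets this be used modulo a prime
element. -/
theorem map_eq_zero_of_map_weightedCofactorSum_eq_zero [CharZero K] (hs : 2 ≤ s)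
    (hG : ∀ i, G i = C (a i) * F + C (b i) * P) (hne : ∀ i, G i ≠ 0)
    (hdist : ∀ i j, i ≠ j → ¬ Associated (G i) (G j))
    {A : Type*} [CommRing A] [IsDomain A] (φ : MvPolynomial (Fin (n + 1)) K →+* A)
    (h₁ : φ (weightedCofactorSum a G) = 0) (h₂ : φ (weightedCofactorSum b G) = 0) :
    φ F = 0 ∧ φ P = 0 := by
  have hCne {c : K} (hc : c ≠ 0) : φ (C c) ≠ 0 := by
    intro h
    exact hc ((φ.comp C).injective (by simpa using h))
  have h3 := congrArg φ (weightedCofactorSum_mul_add hG)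
  rw [map_add, map_mul, map_mul, h₁, h₂, zero_mul, zero_mul, zero_add, map_mul, map_prod,
    ← map_natCast (C : K →+* MvPolynomial (Fin (n + 1)) K)] at h3
  obtain ⟨i, -, hi⟩ := Finset.prod_eq_zero_iff.1
    ((mul_eq_zero.1 h3.symm).resolve_left (hCne (by simp; omega)))
  rw [map_weightedCofactorSum φ _ hi] at h₁ h₂
  have h4 : ∏ j ∈ Finset.univ.erase i, φ (G j) = 0 := by
    rcases pencil_coeff_ne_zero hG hne i with h | h
    · exact (mul_eq_zero.1 h₁).resolve_left (hCne h)
    · exact (mul_eq_zero.1 h₂).resolve_left (hCne h)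
  obtain ⟨j, hj, hj0⟩ := Finset.prod_eq_zero_iff.1 h4
  exact map_eq_zero_of_map_pencil_eq_zero hG φ
    (pencil_det_ne_zero hG hne hdist (Finset.ne_of_mem_erase hj).symm) hi hj0

theorem isWeaklyRegular_weightedCofactorSum [CharZero K] (hs : 2 ≤ s)
    (hreg : IsWeaklyRegular (MvPolynomial (Fin (n + 1)) K) [F, P])
    (hG : ∀ i, G i = C (a i) * F + C (b i) * P) (hne : ∀ i, G i ≠ 0)
    (hdist : ∀ i j, i ≠ j → ¬ Associated (G i) (G j)) (hF0 : eval 0 F = 0) (hP0 : eval 0 P = 0) :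
    IsWeaklyRegular (MvPolynomial (Fin (n + 1)) K)
      [weightedCofactorSum a G, weightedCofactorSum b G] := by
  have hprime : ∀ x, x ∣ weightedCofactorSum a G → x ∣ weightedCofactorSum b G → ¬ Prime x := by
    intro x hx₁ hx₂ hx
    have : (Ideal.span {x}).IsPrime := (Ideal.span_singleton_prime hx.ne_zero).2 hx
    have h := map_eq_zero_of_map_weightedCofactorSum_eq_zero hs hG hne hdist
      (Ideal.Quotient.mk (Ideal.span {x}))
      (Ideal.Quotient.eq_zero_iff_mem.2 (Ideal.mem_span_singleton.2 hx₁))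
      (Ideal.Quotient.eq_zero_iff_mem.2 (Ideal.mem_span_singleton.2 hx₂))
    rw [Ideal.Quotient.eq_zero_iff_mem, Ideal.Quotient.eq_zero_iff_mem, Ideal.mem_span_singleton,
      Ideal.mem_span_singleton] at h
    exact hx.not_isUnit (isUnit_of_dvd_of_isRegular_pair hreg h.1 h.2)
  have hF : F ≠ 0 := fun h ↦ one_ne_zero
    (((isWeaklyRegular_pair_iff F P).1 hreg).1 1 (by simp [h]))
  -- If `H₁ = 0`, then `H₂` is nonzero and vanishes at the origin, so it has a prime factor, which
  -- also divides `H₁`.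
  have h0 : weightedCofactorSum a G ≠ 0 := by
    intro h0
    have hb : weightedCofactorSum b G ≠ 0 := fun h ↦ hF
      (map_eq_zero_of_map_weightedCofactorSum_eq_zero hs hG hne hdist (RingHom.id _) h0 h).1
    have hu : ¬ IsUnit (weightedCofactorSum b G) := by
      intro hu
      refine (hu.map (eval (0 : Fin (n + 1) → K))).ne_zero ?_
      refine RingHom.mem_ker.1 (weightedCofactorSum_mem hs b fun i ↦ ?_)
      rw [RingHom.mem_ker, hG, map_add, map_mul, map_mul, hF0, hP0, mul_zero, mul_zero, add_zero]
    obtain ⟨x, hx, hxb⟩ := WfDvdMonoid.exists_irreducible_factor hu hb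
    exact hprime x (h0 ▸ dvd_zero x) hxb (UniqueFactorizationMonoid.irreducible_iff_prime.1 hx)
  exact isWeaklyRegular_pair_of_isRelPrime h0
    ((UniqueFactorizationMonoid.isRelPrime_iff_no_prime_factors h0).2 hprime)

theorem eval_euler {f : MvPolynomial (Fin (n + 1)) K} (hf : f.IsHomogeneous d)
    (x : Fin (n + 1) → K) : ∑ k, x k * eval x (pderiv k f) = d * eval x f := by
  have := congrArg (eval x) hf.sum_X_mul_pderiv
  simpa using this

/-- The singular locus of the arrangement is the base locus of the pencil. -/
theorem eval_eq_zero_of_eval_pderiv_prod_eq_zero [CharZero K] (hs : 2 ≤ s) (hd : d ≠ 0)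
    (hF : F.IsHomogeneous d) (hP : P.IsHomogeneous d)
    (hG : ∀ i, G i = C (a i) * F + C (b i) * P)
    (hsmooth : ∀ i, IsSmoothCutOut ![G i])
    (hdist : ∀ i j, i ≠ j → ¬ Associated (G i) (G j)) {x : Fin (n + 1) → K} (hx : x ≠ 0)
    (hzero : ∀ k, eval x (pderiv k (∏ i, G i)) = 0) : eval x F = 0 ∧ eval x P = 0 := by
  have hne i := ne_zero_of_isSmoothCutOut (hsmooth i)
  simp only [pderiv_prod_eq hG, map_add, map_mul] at hzero
  set u := eval x (weightedCofactorSum a G) with hu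
  set v := eval x (weightedCofactorSum b G) with hv
  -- Euler's formula contracts the vanishing partials with `x`. The factor `d` cancels in
  -- characteristic zero.
  have h1 : u * eval x F + v * eval x P = 0 := by
    have h2 : ∑ k, x k * (u * eval x (pderiv k F) + v * eval x (pderiv k P)) = 0 :=
      Finset.sum_eq_zero fun k _ ↦ by rw [hzero k, mul_zero]
    have h3 : ∑ k, x k * (u * eval x (pderiv k F) + v * eval x (pderiv k P)) =
        u * (d * eval x F) + v * (d * eval x P) := by
      rw [← eval_euler hF, ← eval_euler hP, Finset.mul_sum, Finset.mul_sum,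
        ← Finset.sum_add_distrib]
      exact Finset.sum_congr rfl fun k _ ↦ by ring
    have hd' : (d : K) ≠ 0 := Nat.cast_ne_zero.2 hd
    refine (mul_eq_zero.1 (?_ : (d : K) * _ = 0)).resolve_left hd'
    rw [← h2, h3]
    ring
  have h4 := congrArg (eval x) (weightedCofactorSum_mul_add hG)
  rw [map_add, map_mul, map_mul, h1, map_mul, map_prod, map_natCast] at h4
  obtain ⟨i, -, hi⟩ := Finset.prod_eq_zero_iff.1 ((mul_eq_zero.1 h4.symm).resolve_left
    (Nat.cast_ne_zero.2 (by omega)))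
  by_contra hcon
  -- Off the base locus only one member passes through `x`, so the gradient of `G` there is a
  -- nonzero multiple of that of `Gᵢ`.
  have hprod : ∏ j ∈ Finset.univ.erase i, eval x (G j) ≠ 0 := by
    refine Finset.prod_ne_zero_iff.2 fun j hj hj0 ↦ hcon ?_
    exact map_eq_zero_of_map_pencil_eq_zero hG (eval x)
      (pencil_det_ne_zero hG hne hdist (Finset.ne_of_mem_erase hj).symm) hi hj0
  rw [map_weightedCofactorSum (eval x) a hi, eval_C] at hu
  rw [map_weightedCofactorSum (eval x) b hi, eval_C] at hv
  have hlin := hsmooth i x hx (by simpa using hi)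
  refine hlin.ne_zero 0 ?_
  ext k
  have h5 : eval x (pderiv k (G i)) = 0 := by
    refine (mul_eq_zero.1 (?_ : _ * (∏ j ∈ Finset.univ.erase i, eval x (G j)) = 0)).resolve_right
      hprod
    rw [hG i, map_add, pderiv_C_mul, pderiv_C_mul, map_add, map_mul, map_mul, eval_C,
      eval_C]
    rw [← hzero k, hu, hv]
    ring
  simpa using h5

theorem exists_minor_ne_zero {ι : Type*} {v w : ι → K} (h : LinearIndependent K ![v, w]) :
    ∃ k l, v k * w l - v l * w k ≠ 0 := by
  by_contra! hcon
  rw [LinearIndependent.pair_iff] at h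
  have hv : v = 0 := by
    ext k
    have := h (w k) (-v k) (by
      ext l
      simp only [Pi.add_apply, Pi.smul_apply, smul_eq_mul, Pi.zero_apply]
      linear_combination -(hcon k l))
    simpa using this.2
  simpa using h 1 0 (by simp [hv])

/-- Cramer's rule for the relations `H₁ ∂ₖF + H₂ ∂ₖP ∈ J` at the indices `k` and `l`. -/
theorem minor_mul_weightedCofactorSum_mem (hG : ∀ i, G i = C (a i) * F + C (b i) * P)
    (k l : Fin (n + 1)) :
    pderiv k F * pderiv l P - pderiv l F * pderiv k P ∈ (jacobianIdeal (∏ i, G i)).colon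
      (Ideal.span {weightedCofactorSum a G, weightedCofactorSum b G} : Set _) := by
  set J := jacobianIdeal (∏ i, G i) with hJ
  have hmem k : weightedCofactorSum a G * pderiv k F + weightedCofactorSum b G * pderiv k P ∈ J := by
    rw [← pderiv_prod_eq hG]
    exact Ideal.subset_span ⟨k, rfl⟩
  refine Submodule.mem_colon.2 fun x hx ↦ ?_
  obtain ⟨y, z, rfl⟩ := Ideal.mem_span_pair.1 hx
  have h1 := J.sub_mem (J.mul_mem_left (y * pderiv l P) (hmem k))
    (J.mul_mem_left (y * pderiv k P) (hmem l))
  have h2 := J.sub_mem (J.mul_mem_left (z * pderiv k F) (hmem l))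
    (J.mul_mem_left (z * pderiv l F) (hmem k))
  convert J.add_mem h1 h2 using 1
  rw [smul_eq_mul]
  ring

theorem jacobianIdeal_le (hG : ∀ i, G i = C (a i) * F + C (b i) * P) :
    jacobianIdeal (∏ i, G i) ≤
      Ideal.span {weightedCofactorSum a G, weightedCofactorSum b G} := by
  refine Ideal.span_le.2 ?_
  rintro _ ⟨k, rfl⟩
  refine Ideal.mem_span_pair.2 ⟨pderiv k F, pderiv k P, ?_⟩
  rw [mul_comm, mul_comm (pderiv k P)]
  exact (pderiv_prod_eq hG k).symm

/-- A nonzero zero of the colon ideal would be a zero of `J`, hence a point of `Z`, where some minor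
is nonzero. The Nullstellensatz turns this into a power of `𝔪`. -/
theorem exists_pow_idealOfVars_le_colon [IsAlgClosed K] [CharZero K] (hs : 2 ≤ s) (hd : d ≠ 0)
    (hF : F.IsHomogeneous d) (hP : P.IsHomogeneous d) (hZ : IsSmoothCutOut ![F, P])
    (hG : ∀ i, G i = C (a i) * F + C (b i) * P)
    (hsmooth : ∀ i, IsSmoothCutOut ![G i])
    (hdist : ∀ i j, i ≠ j → ¬ Associated (G i) (G j)) :
    ∃ k : ℕ, idealOfVars (Fin (n + 1)) K ^ k ≤ (jacobianIdeal (∏ i, G i)).colon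
      (Ideal.span {weightedCofactorSum a G, weightedCofactorSum b G} : Set _) := by
  refine Ideal.exists_pow_le_of_le_radical_of_fg ?_ (idealOfVars_fg _ _)
  set Q := (jacobianIdeal (∏ i, G i)).colon
      (Ideal.span {weightedCofactorSum a G, weightedCofactorSum b G} : Set _) with hQ
  have hzero : ∀ x ∈ zeroLocus K Q, x = 0 := by
    intro x hx
    by_contra hx0
    have hFP := eval_eq_zero_of_eval_pderiv_prod_eq_zero hs hd hF hP hG hsmooth hdist hx0
      fun k ↦ hx _ (Ideal.le_colon (Ideal.subset_span ⟨k, rfl⟩))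
    obtain ⟨k, l, hkl⟩ := exists_minor_ne_zero
      (linearIndependent_of_isSmoothCutOut hZ hx0 hFP.1 hFP.2)
    have h := hx _ (minor_mul_weightedCofactorSum_mem hG k l)
    exact hkl (by simpa using h)
  rw [← vanishingIdeal_zeroLocus_eq_radical (K := K), idealOfVars, Ideal.span_le]
  rintro _ ⟨j, rfl⟩
  refine mem_vanishingIdeal_iff.2 fun x hx ↦ ?_
  simp [hzero x hx]

theorem span_pair_le_radical_jacobianIdeal [IsAlgClosed K] [CharZero K] (hs : 2 ≤ s) (hd : d ≠ 0)
    (hF : F.IsHomogeneous d) (hP : P.IsHomogeneous d)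
    (hF0 : eval 0 F = 0) (hP0 : eval 0 P = 0)
    (hG : ∀ i, G i = C (a i) * F + C (b i) * P)
    (hsmooth : ∀ i, IsSmoothCutOut ![G i])
    (hdist : ∀ i j, i ≠ j → ¬ Associated (G i) (G j)) :
    Ideal.span {F, P} ≤ (jacobianIdeal (∏ i, G i)).radical := by
  have key : ∀ x ∈ zeroLocus K (jacobianIdeal (∏ i, G i)), eval x F = 0 ∧ eval x P = 0 := by
    intro x hx
    by_cases hx0 : x = 0
    · rw [hx0]; exact ⟨hF0, hP0⟩
    · exact eval_eq_zero_of_eval_pderiv_prod_eq_zero hs hd hF hP hG hsmooth hdist hx0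
        fun k ↦ hx _ (Ideal.subset_span ⟨k, rfl⟩)
  rw [← vanishingIdeal_zeroLocus_eq_radical (K := K), Ideal.span_le]
  rintro _ (rfl | rfl)
  exacts [mem_vanishingIdeal_iff.2 fun x hx ↦ (key x hx).1,
    mem_vanishingIdeal_iff.2 fun x hx ↦ (key x hx).2]

end Pencil

/-! ### The codimension two components -/

section TopDimensionalPart

open RingTheory.Sequence

universe u

theorem height_radical {A : Type*} [CommRing A] (I : Ideal A) : I.radical.height = I.height := by
  rw [Ideal.height_eq_inf_minimalPrimes, Ideal.height_eq_inf_minimalPrimes,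
    Ideal.radical_minimalPrimes]

variable {K : Type u} [Field K] [IsAlgClosed K] {N : ℕ}

/-- Every component has height at least 2, because its radical contains `F` and `P`. Components of
other heights are invisible at the height two primes of `(f, g)`, and at the height two components
`J` and `(f, g)` agree since a power of `𝔪` carries one into the other. -/
theorem codimTwoPart_eq_span_pair {f g F P : MvPolynomial (Fin (N + 1 + 1 + 1)) K}
    (hfg : IsWeaklyRegular (MvPolynomial (Fin (N + 1 + 1 + 1)) K) [f, g])
    (hFP : IsWeaklyRegular (MvPolynomial (Fin (N + 1 + 1 + 1)) K) [F, P])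
    {J : Ideal (MvPolynomial (Fin (N + 1 + 1 + 1)) K)} (hJ : J ≤ Ideal.span {f, g})
    (hrad : Ideal.span {F, P} ≤ J.radical) {k : ℕ}
    (hk : idealOfVars (Fin (N + 1 + 1 + 1)) K ^ k ≤ J.colon (Ideal.span {f, g} : Set _))
    {t : Finset (Ideal (MvPolynomial (Fin (N + 1 + 1 + 1)) K))}
    (ht : Submodule.IsMinimalPrimaryDecomposition J t) :
    codimTwoPart (n := N + 1 + 1) t = Ideal.span {f, g} := by
  have hJq {q : Ideal _} (hq : q ∈ t) : J ≤ q := by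
    rw [← ht.inf_eq]
    exact Finset.inf_le hq
  apply le_antisymm
  · intro u hu
    simp only [codimTwoPart, Ideal.mem_iInf] at hu
    by_contra huI
    obtain ⟨w, hw, hle⟩ := exists_isPrime_colon_ge _ huI
    set p := (Ideal.span {f, g}).colon {w} with hp
    have hp2 : p.height ≤ 2 := height_colon_le_two hfg hw
    -- A component inside `p` has height squeezed to exactly 2. Hence some `v ∉ p` lies in all the
    -- others, and `vu ∈ J ⊆ (f, g)` contradicts the choice of `p`.
    have hnot : ¬ (t.filter fun q ↦ q.height ≠ 2).inf id ≤ p := by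
      rw [hw.inf_le']
      rintro ⟨q, hq, hqp⟩
      rw [Finset.mem_filter] at hq
      have hq1 : q.radical ≤ p := (Ideal.radical_mono hqp).trans hw.radical.le
      have hprime : q.radical.IsPrime := Ideal.isPrime_radical (ht.primary hq.1)
      have h1 : 2 ≤ q.radical.height := two_le_height_of_isRegular hFP hprime
        (hrad.trans (Ideal.radical_mono (hJq hq.1)))
      have h2 : q.radical.height ≤ 2 := (Ideal.height_mono hq1).trans hp2
      exact hq.2 ((height_radical q).symm.trans (le_antisymm h2 h1))
    obtain ⟨v, hv, hvp⟩ := SetLike.not_le_iff_exists.1 hnot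
    refine hvp (hle (mem_colon_singleton_iff.2 (hJ ?_)))
    rw [← ht.inf_eq, Submodule.mem_finsetInf]
    intro (q : Ideal _) hq
    by_cases hq2 : q.height = 2
    · exact q.mul_mem_left _ (hu q ⟨hq, hq2⟩)
    · exact q.mul_mem_right _
        ((Submodule.mem_finsetInf.1 hv) q (Finset.mem_filter.2 ⟨hq, hq2⟩))
  · refine le_iInf₂ fun q hq u hu ↦ ?_
    have hprimary : q.IsPrimary := ht.primary hq.1
    have hprime : q.radical.IsPrime := Ideal.isPrime_radical hprimary
    have hnot : ¬ idealOfVars (Fin (N + 1 + 1 + 1)) K ^ k ≤ q.radical := fun h ↦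
      not_idealOfVars_le_of_height_le_two hprime ((height_radical q).trans hq.2).le
        (hprime.le_of_pow_le h)
    obtain ⟨v, hv, hvq⟩ := SetLike.not_le_iff_exists.1 hnot
    have h1 : u * v ∈ q := by
      rw [mul_comm]
      exact hJq hq.1 (Submodule.mem_colon.1 (hk hv) u hu)
    exact ((Ideal.isPrimary_iff.1 hprimary).2 h1).resolve_right hvq

end TopDimensionalPart

/-! ### Positivity of the degree -/

theorem eval_zero_eq_zero_of_isHomogeneous {σ K : Type*} [CommRing K] {f : MvPolynomial σ K}
    {d : ℕ} (hd : d ≠ 0) (hf : f.IsHomogeneous d) : eval 0 f = 0 := by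
  rw [eval_zero, constantCoeff_eq]
  exact hf.coeff_eq_zero (by simpa using hd.symm)

/-- In degree zero `F` would be a nonzero constant, hence a unit. Positivity is needed for Euler's
formula and for vanishing at the origin. -/
theorem degree_ne_zero_of_isRegular_pair {σ K : Type*} [Field K] {F P : MvPolynomial σ K} {d : ℕ}
    (hF : F.IsHomogeneous d) (h : RingTheory.Sequence.IsRegular (MvPolynomial σ K) [F, P]) :
    d ≠ 0 := by
  rintro rfl
  have hC := totalDegree_eq_zero_iff_eq_C.1 ((totalDegree_zero_iff_isHomogeneous σ).2 hF)
  have hF0 : F ≠ 0 := fun h0 ↦ one_ne_zero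
    (((isWeaklyRegular_pair_iff F P).1 h.toIsWeaklyRegular).1 1 (by simp [h0]))
  have hc : coeff 0 F ≠ 0 := fun h0 ↦ hF0 (by rw [hC, h0, C_0])
  refine span_pair_ne_top h (Ideal.eq_top_of_isUnit_mem _ (Ideal.subset_span (by simp))
    (?_ : IsUnit F))
  rw [hC]
  exact (isUnit_iff_ne_zero.2 hc).map C

end JacobianArrangement

end

/-! ### The theorem -/

open JacobianArrangement

theorem theorem3p6 {K : Type*} [Field K] [IsAlgClosed K] [CharZero K]
    (n s d : ℕ) (hn : 2 ≤ n) (hs : 2 ≤ s)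
    (F P : MvPolynomial (Fin (n + 1)) K)
    (hF : F.IsHomogeneous d) (hP : P.IsHomogeneous d)
    (hreg : RingTheory.Sequence.IsRegular (MvPolynomial (Fin (n + 1)) K) [F, P])
    (hZ : JacobianArrangement.IsSmoothCutOut ![F, P])
    (a b : Fin s → K) (G : Fin s → MvPolynomial (Fin (n + 1)) K)
    (hG : ∀ i, G i = MvPolynomial.C (a i) * F + MvPolynomial.C (b i) * P)
    (hGsmooth : ∀ i, JacobianArrangement.IsSmoothCutOut ![G i])
    (hGdistinct : ∀ i j, i ≠ j → ¬ Associated (G i) (G j))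
    (H₁ H₂ : MvPolynomial (Fin (n + 1)) K)
    (hH₁ : H₁ = JacobianArrangement.weightedCofactorSum a G)
    (hH₂ : H₂ = JacobianArrangement.weightedCofactorSum b G)
    (J : Ideal (MvPolynomial (Fin (n + 1)) K))
    (hJ : J = JacobianArrangement.jacobianIdeal (∏ i, G i)) :
    -- the saturation is a complete intersection of type `((s - 1) d, (s - 1) d)`
    JacobianArrangement.saturation J = Ideal.span {H₁, H₂} ∧
    H₁.IsHomogeneous ((s - 1) * d) ∧ H₂.IsHomogeneous ((s - 1) * d) ∧
    RingTheory.Sequence.IsRegular (MvPolynomial (Fin (n + 1)) K) [H₁, H₂] ∧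
    -- the top dimensional part, from any minimal primary decomposition, is the saturation
    (∀ t : Finset (Ideal (MvPolynomial (Fin (n + 1)) K)),
      Submodule.IsMinimalPrimaryDecomposition J t →
        JacobianArrangement.codimTwoPart t = JacobianArrangement.saturation J) ∧
    JacobianArrangement.IsACM (JacobianArrangement.saturation J) ∧
    -- the radical is the saturated ideal `(F, P)` of `Z`
    J.radical = Ideal.span {F, P} ∧
    JacobianArrangement.IsACM J.radical := by
  obtain ⟨N, rfl⟩ : ∃ N, n = N + 1 + 1 := ⟨n - 2, by omega⟩
  have hd := degree_ne_zero_of_isRegular_pair hF hreg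
  have hF0 := eval_zero_eq_zero_of_isHomogeneous hd hF
  have hP0 := eval_zero_eq_zero_of_isHomogeneous hd hP
  have hne i := ne_zero_of_isSmoothCutOut (hGsmooth i)
  have hGhom i : (G i).IsHomogeneous d := by
    rw [hG i]
    exact (hF.C_mul _).add (hP.C_mul _)
  have hFPreg := hreg.toIsWeaklyRegular
  have hHreg := isWeaklyRegular_weightedCofactorSum hs hFPreg hG hne hGdistinct hF0 hP0
  have hHle : Ideal.span {H₁, H₂} ≤ Ideal.span {F, P} := by
    have hGmem i : G i ∈ Ideal.span {F, P} := Ideal.mem_span_pair.2 ⟨_, _, (hG i).symm⟩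
    rw [Ideal.span_le, hH₁, hH₂]
    rintro _ (rfl | rfl)
    exacts [weightedCofactorSum_mem hs a hGmem, weightedCofactorSum_mem hs b hGmem]
  have hJle := jacobianIdeal_le hG
  obtain ⟨k, hk⟩ := exists_pow_idealOfVars_le_colon hs hd hF hP hZ hG hGsmooth hGdistinct
  have hradge := span_pair_le_radical_jacobianIdeal hs hd hF hP hF0 hP0 hG hGsmooth hGdistinct
  have hH₁hom := isHomogeneous_weightedCofactorSum a hGhom
  have hH₂hom := isHomogeneous_weightedCofactorSum b hGhom
  rw [← hH₁, ← hH₂] at hHreg hJle hk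
  rw [← hH₁] at hH₁hom
  rw [← hH₂] at hH₂hom
  rw [← hJ] at hJle hk hradge
  have hsat : saturation J = Ideal.span {H₁, H₂} := by
    ext u
    rw [mem_saturation_iff]
    constructor
    · rintro ⟨m, hm⟩
      exact mem_span_pair_of_forall_mul_mem hHreg fun v hv ↦ hJle (hm v hv)
    · intro hu
      refine ⟨k, fun v hv ↦ ?_⟩
      rw [mul_comm]
      exact Submodule.mem_colon.1 (hk hv) u hu
  -- One inclusion is `J ⊆ (H₁, H₂) ⊆ (F, P)` with the last ideal radical, and the other is the
  -- Nullstellensatz on the singular locus.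
  have hrad : J.radical = Ideal.span {F, P} :=
    le_antisymm ((Ideal.radical_mono (hJle.trans hHle)).trans
      (isRadical_span_pair hFPreg hZ)) hradge
  refine ⟨hsat, hH₁hom, hH₂hom, isRegular_pair_of_ne_top hHreg ?_, fun t ht ↦ ?_, ?_, hrad, ?_⟩
  · exact fun h ↦ span_pair_ne_top hreg (top_le_iff.1 (h ▸ hHle))
  · rw [hsat]
    exact codimTwoPart_eq_span_pair hHreg hFPreg hJle hradge hk ht
  · rw [hsat]
    exact isACM_span_pair hH₁hom hH₂hom hHreg
  · rw [hrad]
    exact isACM_span_pair hF hP hFPreg
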